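/- Let $(\overline M,\overline g)$ be an $(m+n)$-dimensional semi-Riemannian manifold (smooth, Hausdorff, second countable, $\overline g$ of constant index) with Levi-Civita connection $\overline\nabla$ and curvature tensor $\overline R(X,Y)Z=\overline\nabla_X\overline\nabla_YZ-\overline\nabla_Y\overline\nabla_XZ-\overline\nabla_{[X,Y]}Z$, and let $M$ be an $m$-dimensional immersed submanifold of codimension $n$ with induced (possibly degenerate) metric $g$. Put $\operatorname{Rad}T_uM=T_uM\cap (T_uM)^\perp$. Assume that $M$ is coisotropic: $\operatorname{Rad}TM$ is a smooth distribution on $M$ of rank $n>0$. Let $S(TM)$ be a screen distribution, i.e. a smooth distribution with $TM=\operatorname{Rad}TM\oplus S(TM)$, and let $P:TM\to S(TM)$ be the corresponding projection. Let $\operatorname{ltr}(TM)$ be a lightlike transversal bundle, i.e. a subbundle of $T\overline M|_M$ with $T\overline M|_M=TM\oplus \operatorname{ltr}(TM)$ which is locally spanned by smooth sections $N_1,\dots,N_n$ orthogonal to $S(TM)$ with $\overline g(\xi_i,N_j)=\delta_{ij}$ and $\overline g(N_i,N_j)=0$ for some local frame $\xi_1,\dots,\xi_n$ of $\operatorname{Rad}TM$.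 Define the induced connection $\nabla$ on $M$ and the second fundamental forms $h^l$ and $\overset{*}{h}$ by $$\overline\nabla_XY=\nabla_XY+h^l(X,Y),\qquad \nabla_X PY=\overset{*}{\nabla}_XPY+\overset{*}{h}(X,PY),$$ with $\nabla_XY\in TM$, $h^l(X,Y)\in \operatorname{ltr}(TM)$, $\overset{*}{\nabla}_XPY\in S(TM)$, $\overset{*}{h}(X,PY)\in\operatorname{Rad}TM$, and let $R$ be the curvature of $\nabla$, $R(X,Y,Z,W)=g(R(X,Y)Z,W)$. Assume that 1. every point of $M$ has an open neighbourhood $\mathcal U$ with frames $\{\xi_i\}$ of $\operatorname{Rad}TM$ and $\{N_i\}$ of $\operatorname{ltr}(TM)$ as above and smooth functions $\varphi_1,\dots,\varphi_n$ on $\mathcal U$ such that, writing $h^l=\sum_i h^l_iN_i$ and $\overset{*}{h}=\sum_i\overset{*}{h}_i\xi_i$, $$\overset{*}{h}_i(X,PY)=\varphi_i\,h^l_i(X,PY)\qquad\text{for all smooth vector fields } X,Y \text{ on }\mathcal U\text{ tangent to } M\text{ and all } i;$$ 2. the distribution $\operatorname{Rad}TM$ is integrable (through every point of $M$ there passes an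 integral manifold); 3. $\overline R(X,PY)\operatorname{Rad}TM\subset \operatorname{Rad}TM$ for all $X,Y$ tangent to $M$. Then the induced curvature $R$ of $M$ is an algebraic curvature tensor: at every $u\in M$ it defines a $4$-linear form $F$ on $T_uM$ with $$F(x,y,z,w)=-F(y,x,z,w)=F(z,w,x,y),\qquad F(x,y,z,w)+F(y,z,x,w)+F(z,x,y,w)=0 .$$ -/

import Mathlib

open scoped Manifold ContDiff

noncomputable section

namespace CoisotropicGeometry

section Ambient

variable {E : Type*} [NormedAddCommGroup E] [NormedSpace ℝ E] [FiniteDimensional ℝ E]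
  {H : Type*} [TopologicalSpace H] {I : ModelWithCorners ℝ E H}
  {M : Type*} [TopologicalSpace M] [ChartedSpace H M] [IsManifold I ∞ M]

/-- The curvature operator of `D`, where `D X Z` stands for `∇_X Z`:
`R(X, Y) Z = ∇_X ∇_Y Z - ∇_Y ∇_X Z - ∇_{[X, Y]} Z`. -/
def curvature
    (D : (Π x : M, TangentSpace I x) → (Π x : M, TangentSpace I x) → Π x : M, TangentSpace I x)
    (X Y Z : Π x : M, TangentSpace I x) : Π x : M, TangentSpace I x :=
  D X (D Y Z) - D Y (D X Z) - D (VectorField.mlieBracket I X Y) Z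

/-- The curvature tensor `R_x(u, v) w` of a covariant derivative on the tangent bundle, evaluated
on tangent vectors through the local extensions of `u`, `v`, `w` that are constant in the
trivialization at `x`; the curvature of a smooth connection is a tensor, so that every other choice
of smooth extensions gives the same value. -/
def curvatureAt (nabla : CovariantDerivative I E (TangentSpace I : M → Type _)) (x : M)
    (u v w : TangentSpace I x) : TangentSpace I x :=
  curvature (fun X Z y ↦ nabla Z y (X y))
    (FiberBundle.extend E u) (FiberBundle.extend E v) (FiberBundle.extend E w) x

variable (I M) in
/-- A semi-Riemannian metric: a smooth field of nondegenerate symmetric bilinear forms of constant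
index on the tangent spaces. -/
structure SemiRiemannianMetric where
  val : ∀ x : M, TangentSpace I x →L[ℝ] TangentSpace I x →L[ℝ] ℝ
  symm : ∀ (x : M) (v w : TangentSpace I x), val x v w = val x w v
  nondegenerate : ∀ (x : M) (v : TangentSpace I x), (∀ w, val x v w = 0) → v = 0
  contMDiff : ContMDiff I (I.prod 𝓘(ℝ, E →L[ℝ] E →L[ℝ] ℝ)) ∞
    (fun x ↦ Bundle.TotalSpace.mk' (E →L[ℝ] E →L[ℝ] ℝ) x (val x))
  constant_index : ∃ ν : ℕ, ∀ x : M, sigNeg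
    (LinearMap.BilinMap.toQuadraticMap (val x).toBilinForm) = ν

/-- `nabla` is the Levi-Civita connection of `g`: the smooth linear connection on the tangent bundle
that is torsion free and satisfies `v g(Y, Z) = g(∇_v Y, Z) + g(Y, ∇_v Z)`. -/
structure SemiRiemannianMetric.IsLeviCivita (g : SemiRiemannianMetric I M)
    (nabla : CovariantDerivative I E (TangentSpace I : M → Type _)) : Prop where
  smooth : CovariantDerivative.ContMDiffCovariantDerivative nabla ∞
  torsion_free : nabla.torsion = 0
  metric : ∀ (x : M) (v : TangentSpace I x) (Y Z : Π x : M, TangentSpace I x),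
    MDifferentiableAt I I.tangent (fun y ↦ (⟨y, Y y⟩ : TangentBundle I M)) x →
    MDifferentiableAt I I.tangent (fun y ↦ (⟨y, Z y⟩ : TangentBundle I M)) x →
    mvfderiv I (fun y ↦ g.val y (Y y) (Z y)) x v =
      g.val x (nabla Y x v) (Z x) + g.val x (Y x) (nabla Z x v)

/-- The vector field `X` is smooth on the set `U`. -/
def SmoothFieldOn (X : Π x : M, TangentSpace I x) (U : Set M) : Prop :=
  ContMDiffOn I I.tangent ∞ (fun x ↦ (⟨x, X x⟩ : TangentBundle I M)) U

/-- The smooth vector fields `X 1, …, X k` on `U` form a frame of the distribution `D` over `U`. -/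
structure IsDistributionFrameOn {k : ℕ} (D : ∀ x : M, Submodule ℝ (TangentSpace I x))
    (X : Fin k → Π x : M, TangentSpace I x) (U : Set M) : Prop where
  smooth : ∀ i, SmoothFieldOn (X i) U
  linearIndependent : ∀ x ∈ U, LinearIndependent ℝ (fun i ↦ X i x)
  span_eq : ∀ x ∈ U, Submodule.span ℝ (Set.range fun i ↦ X i x) = D x

/-- `D` is a smooth distribution of rank `k`. -/
def IsSmoothDistribution (k : ℕ) (D : ∀ x : M, Submodule ℝ (TangentSpace I x)) : Prop :=
  ∀ x : M, ∃ U : Set M, IsOpen U ∧ x ∈ U ∧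
    ∃ X : Fin k → Π y : M, TangentSpace I y, IsDistributionFrameOn D X U

/-- The distribution `D` of rank `k` is integrable: through every point of `M` there passes an
integral manifold of `D`, here given by a local parametrization `j` on an open set `U` of `ℝ^k`. -/
def IsIntegrableDistribution (k : ℕ) (D : ∀ x : M, Submodule ℝ (TangentSpace I x)) : Prop :=
  ∀ x : M, ∃ (U : Set (EuclideanSpace ℝ (Fin k))) (j : EuclideanSpace ℝ (Fin k) → M),
    IsOpen U ∧ (∃ t ∈ U, j t = x) ∧ ContMDiffOn (𝓡 k) I ∞ j U ∧
    ∀ t ∈ U, Function.Injective (mfderiv (𝓡 k) I j t) ∧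
      LinearMap.range (mfderiv (𝓡 k) I j t).toLinearMap = D (j t)

end Ambient

/-- An algebraic curvature tensor on a real vector space. -/
structure IsAlgebraicCurvatureTensor {V : Type*} [AddCommGroup V] [Module ℝ V]
    (F : V →ₗ[ℝ] V →ₗ[ℝ] V →ₗ[ℝ] V →ₗ[ℝ] ℝ) : Prop where
  antisymm : ∀ x y z w, F x y z w = -F y x z w
  pair_symm : ∀ x y z w, F x y z w = F z w x y
  bianchi : ∀ x y z w, F x y z w + F y z x w + F z x y w = 0

/-- The differential of an immersion is injective at every point. -/
theorem injective_mfderiv_of_isImmersion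
    {E : Type*} [NormedAddCommGroup E] [NormedSpace ℝ E]
    {H : Type*} [TopologicalSpace H] {I : ModelWithCorners ℝ E H}
    {M : Type*} [TopologicalSpace M] [ChartedSpace H M] [IsManifold I ∞ M]
    {E' : Type*} [NormedAddCommGroup E'] [NormedSpace ℝ E']
    {H' : Type*} [TopologicalSpace H'] {I' : ModelWithCorners ℝ E' H'}
    {N : Type*} [TopologicalSpace N] [ChartedSpace H' N] [IsManifold I' ∞ N]
    {f : M → N} (hf : Manifold.IsImmersion I I' ∞ f) (x : M) :
    Function.Injective (mfderiv I I' f x) := by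
  have h := hf.isImmersionAt x
  set φ := h.domChart
  set ψ := h.codChart
  have hx : x ∈ φ.source := h.mem_domChart_source
  have hfx : f x ∈ ψ.source := h.mem_codChart_source
  have hφ1 : φ ∈ IsManifold.maximalAtlas I 1 M :=
    IsManifold.maximalAtlas_subset_of_le (by simp) h.domChart_mem_maximalAtlas
  have hψ1 : ψ ∈ IsManifold.maximalAtlas I' 1 N :=
    IsManifold.maximalAtlas_subset_of_le (by simp) h.codChart_mem_maximalAtlas
  have hφ : MDifferentiableAt I 𝓘(ℝ, E) (φ.extend I) x :=
    I.mdifferentiableAt.comp x (mdifferentiableAt_of_mem_maximalAtlas hφ1 hx)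
  have hψ : MDifferentiableAt I' 𝓘(ℝ, E') (ψ.extend I') (f x) :=
    I'.mdifferentiableAt.comp (f x) (mdifferentiableAt_of_mem_maximalAtlas hψ1 hfx)
  have hfd : MDifferentiableAt I I' f x := (hf.contMDiff x).mdifferentiableAt (by simp)
  let A : E' →L[ℝ] E := (ContinuousLinearMap.fst ℝ E h.complement).comp
    (h.equiv.symm : E' →L[ℝ] E × h.complement)
  have hA : MDifferentiableAt 𝓘(ℝ, E') 𝓘(ℝ, E) A (ψ.extend I' (f x)) :=
    A.differentiableAt.mdifferentiableAt
  have key : (A ∘ ψ.extend I') ∘ f =ᶠ[nhds x] φ.extend I := by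
    filter_upwards [φ.open_source.mem_nhds hx] with y hy
    have hy' : y ∈ (φ.extend I).source := by simpa using hy
    have := h.writtenInCharts ((φ.extend I).map_source hy')
    simp only [Function.comp_apply] at this ⊢
    rw [(φ.extend I).left_inv hy'] at this
    rw [this]
    simp [A]
  have hcomp : mfderiv I 𝓘(ℝ, E) (φ.extend I) x =
      (mfderiv I' 𝓘(ℝ, E) (A ∘ ψ.extend I') (f x)).comp (mfderiv I I' f x) := by
    rw [← key.mfderiv_eq]
    exact mfderiv_comp x (hA.comp _ hψ) hfd
  have hinj : Function.Injective (mfderiv I 𝓘(ℝ, E) (φ.extend I) x) := by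
    have hm : φ.MDifferentiable I I := by
      refine ⟨fun y hy => ?_, fun y hy => ?_⟩
      · exact (mdifferentiableAt_of_mem_maximalAtlas hφ1 hy).mdifferentiableWithinAt
      · exact (mdifferentiableAt_symm_of_mem_maximalAtlas hφ1 hy).mdifferentiableWithinAt
    have : mfderiv I 𝓘(ℝ, E) (φ.extend I) x =
      (mfderiv I 𝓘(ℝ, E) I (φ x)).comp (mfderiv I I φ x) := 
      mfderiv_comp x I.mdifferentiableAt (hm.mdifferentiableAt hx)
    rw [this, I.hasMFDerivAt.mfderiv]
    exact hm.mfderiv_injective hx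
  rw [hcomp] at hinj
  exact Function.Injective.of_comp (f := mfderiv I' 𝓘(ℝ, E) (A ∘ ψ.extend I') (f x)) hinj

section Submanifold

variable {E : Type*} [NormedAddCommGroup E] [NormedSpace ℝ E] [FiniteDimensional ℝ E]
  {H : Type*} [TopologicalSpace H] {I : ModelWithCorners ℝ E H}
  {M : Type*} [TopologicalSpace M] [ChartedSpace H M] [IsManifold I ∞ M]
  {E' : Type*} [NormedAddCommGroup E'] [NormedSpace ℝ E'] [FiniteDimensional ℝ E']
  {H' : Type*} [TopologicalSpace H'] {I' : ModelWithCorners ℝ E' H'}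
  {N : Type*} [TopologicalSpace N] [ChartedSpace H' N] [IsManifold I' ∞ N]

/-- The covariant derivative `∇_x V` of a vector field `V` along `f : M → N` in the direction
`x ∈ T_p M`, i.e. the pullback connection. In the trivialization of `TN` at `f p`, with constant
frame `∂_k`, one has `V = ∑ V^k ∂_k ∘ f` and `∇_x V = ∑ (x V^k) ∂_k + ∑ V^k(p) ∇_{df x} ∂_k`; the
second sum is the derivative of the extension of `V p` with constant coefficients. -/
def covDerivAlong (nabla : CovariantDerivative I' E' (TangentSpace I' : N → Type _)) (f : M → N)
    (V : Π q : M, TangentSpace I' (f q)) (p : M) (x : TangentSpace I p) : TangentSpace I' (f p) :=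
  (trivializationAt E' (TangentSpace I' : N → Type _) (f p)).symm (f p)
      (mvfderiv I (fun q ↦
        (trivializationAt E' (TangentSpace I' : N → Type _) (f p)
          (⟨f q, V q⟩ : TangentBundle I' N)).2) p x)
    + nabla (FiberBundle.extend E' (V p)) (f p) (mfderiv I I' f p x)

/-- The metric induced on `M` by `f : M → N`; it may be degenerate. -/
def inducedMetric (g : SemiRiemannianMetric I' N) (f : M → N) (p : M) :
    LinearMap.BilinForm ℝ (TangentSpace I p) :=
  (g.val (f p)).toBilinForm.compl₁₂ (mfderiv I I' f p).toLinearMap (mfderiv I I' f p).toLinearMap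

/-- The radical `Rad T_p M = T_p M ∩ (T_p M)^⊥`. -/
def radical (g : SemiRiemannianMetric I' N) (f : M → N) (p : M) :
    Submodule ℝ (TangentSpace I p) :=
  LinearMap.ker (inducedMetric g f p)

variable (I) in
/-- The submanifold `f : M → N` is coisotropic of codimension `r`: it is lightlike, i.e. its radical
is a smooth distribution of positive rank, and this rank equals the codimension `r`. -/
def IsCoisotropic (g : SemiRiemannianMetric I' N) (f : M → N) (r : ℕ) : Prop :=
  Module.finrank ℝ E' = Module.finrank ℝ E + r ∧ 0 < r ∧
    IsSmoothDistribution r (radical (I := I) g f)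

variable (I) in
/-- A screen distribution `S(TM)`: a smooth distribution complementary to the radical in `TM`.
It is automatically orthogonal to the radical, and the metric is nondegenerate on it. -/
structure ScreenDistribution (g : SemiRiemannianMetric I' N) (f : M → N) where
  fiber : ∀ p : M, Submodule ℝ (TangentSpace I p)
  isCompl : ∀ p, IsCompl (fiber p) (radical g f p)
  smooth : ∃ k : ℕ, IsSmoothDistribution k fiber

/-- The projection `P` of `TM` onto the screen distribution along the radical. -/
def ScreenDistribution.proj {g : SemiRiemannianMetric I' N} {f : M → N}
    (S : ScreenDistribution I g f) (p : M) : TangentSpace I p →ₗ[ℝ] TangentSpace I p :=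
  (S.fiber p).projection (radical g f p) (S.isCompl p)

/-- A pair of local frames over `U`: `ξ 1, …, ξ r` of the radical, and `ν 1, …, ν r` of a family
`L` of subspaces of the ambient tangent spaces, such that the `ν i` are smooth and orthogonal to the
screen distribution, `g(ξ i, ν j) = δ_ij` and `g(ν i, ν j) = 0`. -/
structure IsNullFramePairOn {g : SemiRiemannianMetric I' N} {f : M → N}
    (S : ScreenDistribution I g f) (L : ∀ p : M, Submodule ℝ (TangentSpace I' (f p))) {r : ℕ}
    (ξ : Fin r → Π p : M, TangentSpace I p) (ν : Fin r → Π p : M, TangentSpace I' (f p))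
    (U : Set M) : Prop where
  frame : IsDistributionFrameOn (radical g f) ξ U
  smooth : ∀ i, ContMDiffOn I I'.tangent ∞ (fun p ↦ (⟨f p, ν i p⟩ : TangentBundle I' N)) U
  span_eq : ∀ p ∈ U, Submodule.span ℝ (Set.range fun i ↦ ν i p) = L p
  orthogonal_screen : ∀ p ∈ U, ∀ i, ∀ x ∈ S.fiber p, g.val (f p) (mfderiv I I' f p x) (ν i p) = 0
  dual : ∀ p ∈ U, ∀ i j, g.val (f p) (mfderiv I I' f p (ξ i p)) (ν j p) = if i = j then 1 else 0
  null : ∀ p ∈ U, ∀ i j, g.val (f p) (ν i p) (ν j p) = 0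

/-- A lightlike transversal bundle `ltr(TM)` of a coisotropic submanifold with screen distribution
`S`: it is complementary to `TM` in the ambient tangent bundle along `M`, and it is locally spanned
by a frame `ν i` as in `IsNullFramePairOn`. -/
structure LightlikeTransversalBundle {g : SemiRiemannianMetric I' N} {f : M → N}
    (S : ScreenDistribution I g f) (r : ℕ) where
  fiber : ∀ p : M, Submodule ℝ (TangentSpace I' (f p))
  isCompl : ∀ p, IsCompl (LinearMap.range (mfderiv I I' f p).toLinearMap) (fiber p)
  exists_frame : ∀ p : M, ∃ U : Set M, IsOpen U ∧ p ∈ U ∧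
    ∃ (ξ : Fin r → Π q : M, TangentSpace I q) (ν : Fin r → Π q : M, TangentSpace I' (f q)),
      IsNullFramePairOn S fiber ξ ν U

variable {g : SemiRiemannianMetric I' N} {f : M → N} {S : ScreenDistribution I g f} {r : ℕ}

/-- The component in `T_p M` of an ambient tangent vector at `f p`, with respect to
`T_{f p} N = T_p M ⊕ ltr(TM)_p`. -/
def tangentialPart (hf : Manifold.IsImmersion I I' ∞ f) (L : LightlikeTransversalBundle S r)
    (p : M) : TangentSpace I' (f p) →ₗ[ℝ] TangentSpace I p :=
  LinearMap.linearProjOfIsCompl (L.fiber p) (mfderiv I I' f p).toLinearMap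
    (injective_mfderiv_of_isImmersion hf p) (L.isCompl p)

/-- The induced connection `∇_X Y` on `M`: the tangential part of the ambient derivative. -/
def inducedConnection (nabla : CovariantDerivative I' E' (TangentSpace I' : N → Type _))
    (hf : Manifold.IsImmersion I I' ∞ f) (L : LightlikeTransversalBundle S r)
    (X Y : Π p : M, TangentSpace I p) : Π p : M, TangentSpace I p :=
  fun p ↦ tangentialPart hf L p
    (covDerivAlong nabla f (fun q ↦ mfderiv I I' f q (Y q)) p (X p))

/-- The lightlike second fundamental form `h^l(X, Y)`: the component in `ltr(TM)` of the ambient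
derivative of `Y` along `X`, according to the Gauss formula. -/
def lightlikeSecondForm (nabla : CovariantDerivative I' E' (TangentSpace I' : N → Type _))
    (hf : Manifold.IsImmersion I I' ∞ f) (L : LightlikeTransversalBundle S r)
    (X Y : Π p : M, TangentSpace I p) : Π p : M, TangentSpace I' (f p) :=
  fun p ↦ covDerivAlong nabla f (fun q ↦ mfderiv I I' f q (Y q)) p (X p) -
    mfderiv I I' f p (inducedConnection nabla hf L X Y p)

/-- The screen second fundamental form `h^*(X, PY)`: the component of `∇_X PY` in the radical. -/
def screenSecondForm (nabla : CovariantDerivative I' E' (TangentSpace I' : N → Type _))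
    (hf : Manifold.IsImmersion I I' ∞ f) (L : LightlikeTransversalBundle S r)
    (X Y : Π p : M, TangentSpace I p) : Π p : M, TangentSpace I p :=
  fun p ↦ inducedConnection nabla hf L X (fun q ↦ S.proj q (Y q)) p -
    S.proj p (inducedConnection nabla hf L X (fun q ↦ S.proj q (Y q)) p)

/-- The local screen second fundamental forms are conformal to the local lightlike ones: around
every point there are frames `ξ i` of the radical and `ν i` of `ltr(TM)` as above, and smooth
functions `φ i`, with `h^*_i(X, PY) = φ i h^l_i(X, PY)` for all `i` and all smooth `X`, `Y`. Here
`h^l(X, PY) = ∑ h^l_i(X, PY) ν i` and `h^*(X, PY) = ∑ h^*_i(X, PY) ξ i`, hence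
`h^l_i(X, PY) = g(h^l(X, PY), ξ i)` and `h^*_i(X, PY) = g(h^*(X, PY), ν i)`. -/
def IsScreenConformal (nabla : CovariantDerivative I' E' (TangentSpace I' : N → Type _))
    (hf : Manifold.IsImmersion I I' ∞ f) (L : LightlikeTransversalBundle S r) : Prop :=
  ∀ p : M, ∃ U : Set M, IsOpen U ∧ p ∈ U ∧
    ∃ (ξ : Fin r → Π q : M, TangentSpace I q) (ν : Fin r → Π q : M, TangentSpace I' (f q))
      (φ : Fin r → M → ℝ),
      IsNullFramePairOn S L.fiber ξ ν U ∧ (∀ i, ContMDiffOn I 𝓘(ℝ, ℝ) ∞ (φ i) U) ∧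
      ∀ X Y : Π q : M, TangentSpace I q, SmoothFieldOn X U → SmoothFieldOn Y U →
        ∀ q ∈ U, ∀ i,
          g.val (f q) (mfderiv I I' f q (screenSecondForm nabla hf L X Y q)) (ν i q) =
            φ i q * g.val (f q)
              (lightlikeSecondForm nabla hf L X (fun q' ↦ S.proj q' (Y q')) q)
              (mfderiv I I' f q (ξ i q))

end Submanifold

end CoisotropicGeometry

end

open CoisotropicGeometry

/-!
Let `h_i` be the Hessian of `f` in the direction `ξ i` and let `K` be the ambient curvature tensor
restricted to `TM`. Differentiating `df (∇_Y Z) = ∇̄_Y df Z - ∑ h_i(Y, Z) ν i` gives the Gauss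
equation, which expresses `g(R(X, Y) Z, W)` as `K(X, Y, Z, PW)` plus products of the `h_i` with the
components `h^*_i` of the screen second fundamental form.

Metric compatibility makes `h_i(x, ξ j)` skew in `i, j`. As the radical is integrable, `h_i(ξ j, x)`
is symmetric in `i, j`, since second derivatives commute on its leaves. Hence `h_i` vanishes on the
radical. Conformality then reads `h^*_i(X, PW) = φ i h_i(X, W)`, and the products become `φ i` times
Kulkarni-Nomizu squares. Finally, since `K(x, Py)` preserves the radical, the pair symmetry of `K`
yields `K(x, y, z, Pw) = K(Px, Py, Pz, Pw)`, so both summands are algebraic curvature tensors.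
-/

namespace CoisotropicGeometry

section LocalCalculus

open Filter Topology

variable {E E' E'' E₃ : Type*} [NormedAddCommGroup E] [NormedSpace ℝ E]
  [NormedAddCommGroup E'] [NormedSpace ℝ E'] [NormedAddCommGroup E''] [NormedSpace ℝ E'']
  [NormedAddCommGroup E₃] [NormedSpace ℝ E₃]

lemma contDiffAt_fderiv {F : E → E'} {t : E} (hF : ContDiffAt ℝ ∞ F t) :
    ContDiffAt ℝ ∞ (fderiv ℝ F) t :=
  hF.fderiv_right (by simp)

lemma eventually_differentiableAt {F : E → E'} {t : E} (hF : ContDiffAt ℝ ∞ F t) :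
    ∀ᶠ s in 𝓝 t, DifferentiableAt ℝ F s := by
  have h1 : ContDiffAt ℝ 1 F t := hF.of_le (by simp)
  filter_upwards [h1.eventually (by simp)] with s hs using hs.differentiableAt (by simp)

lemma minSmoothness_two_le : minSmoothness ℝ 2 ≤ (∞ : ℕ∞ω) := by
  rw [minSmoothness_of_isRCLikeNormedField]
  exact WithTop.coe_le_coe.2 (le_top : (2 : ℕ∞) ≤ ⊤)

lemma fderiv_fderiv_symm {F : E → E'} {t : E} (hF : ContDiffAt ℝ ∞ F t) (x y : E) :
    fderiv ℝ (fderiv ℝ F) t x y = fderiv ℝ (fderiv ℝ F) t y x :=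
  hF.isSymmSndFDerivAt minSmoothness_two_le x y

lemma fderiv_clm_apply₂ {A : E → E' →L[ℝ] E'' →L[ℝ] E₃} {V : E → E'} {W : E → E''} {t : E}
    (hA : DifferentiableAt ℝ A t) (hV : DifferentiableAt ℝ V t) (hW : DifferentiableAt ℝ W t)
    (x : E) :
    fderiv ℝ (fun s ↦ A s (V s) (W s)) t x =
      fderiv ℝ A t x (V t) (W t) + A t (fderiv ℝ V t x) (W t) + A t (V t) (fderiv ℝ W t x) := by
  rw [fderiv_clm_apply (hA.clm_apply hV) hW, fderiv_clm_apply hA hV]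
  simp only [add_apply, ContinuousLinearMap.comp_apply, ContinuousLinearMap.flip_apply]
  abel

/-- The covariant derivative of a vector field `V` along `F : E → E'` for the linear connection with
Christoffel symbols `Γ`, where `Γ y w v` is the derivative of the constant field `w` along `v`. -/
noncomputable def alongDeriv (Γ : E' → E' →L[ℝ] E' →L[ℝ] E') (F V : E → E') (t x : E) : E' :=
  fderiv ℝ V t x + Γ (F t) (V t) (fderiv ℝ F t x)

/-- The curvature `R_y(c, b) a` of the linear connection with Christoffel symbols `Γ`. -/
noncomputable def localCurvature (Γ : E' → E' →L[ℝ] E' →L[ℝ] E') (y c b a : E') : E' :=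
  fderiv ℝ Γ y c a b - fderiv ℝ Γ y b a c + Γ y (Γ y a b) c - Γ y (Γ y a c) b

/-- The second derivative of `F`, corrected by the Christoffel symbols of the target. -/
noncomputable def localHessian (Γ : E' → E' →L[ℝ] E' →L[ℝ] E') (F : E → E') (t x y : E) : E' :=
  fderiv ℝ (fderiv ℝ F) t x y + Γ (F t) (fderiv ℝ F t y) (fderiv ℝ F t x)

/-- `Γ` are the Christoffel symbols of the Levi-Civita connection of `G` near `y₀`. -/
structure IsLocalLeviCivita (G : E' → E' →L[ℝ] E' →L[ℝ] ℝ) (Γ : E' → E' →L[ℝ] E' →L[ℝ] E')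
    (y₀ : E') : Prop where
  smooth_metric : ContDiffAt ℝ ∞ G y₀
  smooth_symbols : ContDiffAt ℝ ∞ Γ y₀
  metric_symm : ∀ y v w, G y v w = G y w v
  torsion_free : ∀ᶠ y in 𝓝 y₀, ∀ v w, Γ y v w = Γ y w v
  compatible : ∀ᶠ y in 𝓝 y₀, ∀ v a b,
    fderiv ℝ G y v a b = G y (Γ y a v) b + G y a (Γ y b v)

variable {G : E' → E' →L[ℝ] E' →L[ℝ] ℝ} {Γ : E' → E' →L[ℝ] E' →L[ℝ] E'} {F V W : E → E'} {t : E}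

lemma alongDeriv_congr (h : V =ᶠ[𝓝 t] W) (x : E) :
    alongDeriv Γ F V t x = alongDeriv Γ F W t x := by
  simp only [alongDeriv, h.fderiv_eq, h.eq_of_nhds]

lemma alongDeriv_smul {a : E → ℝ} (ha : DifferentiableAt ℝ a t) (hV : DifferentiableAt ℝ V t)
    (x : E) :
    alongDeriv Γ F (fun s ↦ a s • V s) t x =
      fderiv ℝ a t x • V t + a t • alongDeriv Γ F V t x := by
  simp only [alongDeriv, fderiv_fun_smul ha hV, add_apply, smul_apply,
    ContinuousLinearMap.smulRight_apply, map_smul]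
  module

lemma alongDeriv_sub_sum {ι : Type*} [Fintype ι] {W : ι → E → E'} (hV : DifferentiableAt ℝ V t)
    (hW : ∀ i, DifferentiableAt ℝ (W i) t) (x : E) :
    alongDeriv Γ F (fun s ↦ V s - ∑ i, W i s) t x =
      alongDeriv Γ F V t x - ∑ i, alongDeriv Γ F (W i) t x := by
  have hsum : DifferentiableAt ℝ (fun s ↦ ∑ i, W i s) t :=
    DifferentiableAt.fun_sum fun i _ ↦ hW i
  simp only [alongDeriv, fderiv_fun_sub hV hsum, fderiv_fun_sum fun i _ ↦ hW i,
    Finset.sum_add_distrib, sub_apply, sum_apply, map_sub, map_sum]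
  abel

lemma alongDeriv_comp {k : E'' → E} {s : E''} (hF : DifferentiableAt ℝ F (k s))
    (hV : DifferentiableAt ℝ V (k s)) (hk : DifferentiableAt ℝ k s) (v : E'') :
    alongDeriv Γ (F ∘ k) (V ∘ k) s v = alongDeriv Γ F V (k s) (fderiv ℝ k s v) := by
  simp only [alongDeriv, fderiv_comp s hF hk, fderiv_comp s hV hk, Function.comp_apply,
    ContinuousLinearMap.comp_apply]

lemma alongDeriv_fderiv_apply {Y : E → E} (hF : ContDiffAt ℝ ∞ F t)
    (hY : DifferentiableAt ℝ Y t) (x : E) :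
    alongDeriv Γ F (fun s ↦ fderiv ℝ F s (Y s)) t x =
      localHessian Γ F t x (Y t) + fderiv ℝ F t (fderiv ℝ Y t x) := by
  have hdF : DifferentiableAt ℝ (fderiv ℝ F) t := (contDiffAt_fderiv hF).differentiableAt (by simp)
  simp only [alongDeriv, localHessian, fderiv_clm_apply hdF hY, add_apply,
    ContinuousLinearMap.comp_apply, ContinuousLinearMap.flip_apply]
  abel

lemma contDiffAt_alongDeriv {Y : E → E} (hΓ : ContDiffAt ℝ ∞ Γ (F t)) (hF : ContDiffAt ℝ ∞ F t)
    (hV : ContDiffAt ℝ ∞ V t) (hY : ContDiffAt ℝ ∞ Y t) :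
    ContDiffAt ℝ ∞ (fun s ↦ alongDeriv Γ F V s (Y s)) t :=
  ((contDiffAt_fderiv hV).clm_apply hY).add
    (((hΓ.comp t hF).clm_apply hV).clm_apply ((contDiffAt_fderiv hF).clm_apply hY))

lemma alongDeriv_alongDeriv {Z : E → E} (hΓ : DifferentiableAt ℝ Γ (F t))
    (hF : ContDiffAt ℝ ∞ F t) (hV : ContDiffAt ℝ ∞ V t) (hZ : DifferentiableAt ℝ Z t) (x : E) :
    alongDeriv Γ F (fun s ↦ alongDeriv Γ F V s (Z s)) t x =
      fderiv ℝ (fderiv ℝ V) t x (Z t) + fderiv ℝ V t (fderiv ℝ Z t x) +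
      (fderiv ℝ Γ (F t) (fderiv ℝ F t x) (V t) (fderiv ℝ F t (Z t)) +
        Γ (F t) (fderiv ℝ V t x) (fderiv ℝ F t (Z t)) +
        Γ (F t) (V t) (fderiv ℝ (fderiv ℝ F) t x (Z t) + fderiv ℝ F t (fderiv ℝ Z t x))) +
      Γ (F t) (alongDeriv Γ F V t (Z t)) (fderiv ℝ F t x) := by
  have hF' : DifferentiableAt ℝ F t := hF.differentiableAt (by simp)
  have hV' : DifferentiableAt ℝ V t := hV.differentiableAt (by simp)
  have hdF : DifferentiableAt ℝ (fderiv ℝ F) t := (contDiffAt_fderiv hF).differentiableAt (by simp)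
  have hdV : DifferentiableAt ℝ (fderiv ℝ V) t := (contDiffAt_fderiv hV).differentiableAt (by simp)
  have hΓF : DifferentiableAt ℝ (fun s ↦ Γ (F s)) t := DifferentiableAt.comp (g := Γ) t hΓ hF'
  have hFZ : DifferentiableAt ℝ (fun s ↦ fderiv ℝ F s (Z s)) t := hdF.clm_apply hZ
  rw [alongDeriv]
  congr 1
  simp only [alongDeriv]
  rw [fderiv_fun_add (hdV.clm_apply hZ) ((hΓF.clm_apply hV').clm_apply hFZ), add_apply,
    fderiv_clm_apply₂ hΓF hV' hFZ, fderiv_fun_comp (g := Γ) t hΓ hF', fderiv_clm_apply hdV hZ,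
    fderiv_clm_apply hdF hZ]
  simp only [add_apply, ContinuousLinearMap.comp_apply, ContinuousLinearMap.flip_apply, map_add]
  abel

lemma alongDeriv_commutator {X Y : E → E}
    (hΓ : DifferentiableAt ℝ Γ (F t)) (hF : ContDiffAt ℝ ∞ F t) (hV : ContDiffAt ℝ ∞ V t)
    (hX : DifferentiableAt ℝ X t) (hY : DifferentiableAt ℝ Y t) :
    alongDeriv Γ F (fun s ↦ alongDeriv Γ F V s (Y s)) t (X t) -
      alongDeriv Γ F (fun s ↦ alongDeriv Γ F V s (X s)) t (Y t) -
      alongDeriv Γ F V t (fderiv ℝ Y t (X t) - fderiv ℝ X t (Y t)) =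
    localCurvature Γ (F t) (fderiv ℝ F t (X t)) (fderiv ℝ F t (Y t)) (V t) := by
  rw [alongDeriv_alongDeriv hΓ hF hV hY, alongDeriv_alongDeriv hΓ hF hV hX,
    fderiv_fderiv_symm hV (X t) (Y t), fderiv_fderiv_symm hF (X t) (Y t)]
  simp only [alongDeriv, localCurvature, map_add, map_sub, add_apply]
  abel

lemma fderiv_metric_along (hG : DifferentiableAt ℝ G (F t))
    (hc : ∀ v a b, fderiv ℝ G (F t) v a b = G (F t) (Γ (F t) a v) b + G (F t) a (Γ (F t) b v))
    (hF : DifferentiableAt ℝ F t) (hV : DifferentiableAt ℝ V t) (hW : DifferentiableAt ℝ W t)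
    (x : E) :
    fderiv ℝ (fun s ↦ G (F s) (V s) (W s)) t x =
      G (F t) (alongDeriv Γ F V t x) (W t) + G (F t) (V t) (alongDeriv Γ F W t x) := by
  have hGF : DifferentiableAt ℝ (fun s ↦ G (F s)) t := DifferentiableAt.comp (g := G) t hG hF
  rw [fderiv_clm_apply₂ hGF hV hW, fderiv_fun_comp (g := G) t hG hF,
    ContinuousLinearMap.comp_apply, hc]
  simp only [alongDeriv, map_add, add_apply]
  ring

lemma localCurvature_antisymm (Γ : E' → E' →L[ℝ] E' →L[ℝ] E') (y c b a : E') :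
    localCurvature Γ y c b a = - localCurvature Γ y b c a := by
  simp only [localCurvature]
  abel

namespace IsLocalLeviCivita

lemma localHessian_symm (h : IsLocalLeviCivita G Γ (F t)) (hF : ContDiffAt ℝ ∞ F t) (x y : E) :
    localHessian Γ F t x y = localHessian Γ F t y x := by
  rw [localHessian, localHessian, fderiv_fderiv_symm hF, h.torsion_free.self_of_nhds]

lemma eventually_fderiv_metric_along (h : IsLocalLeviCivita G Γ (F t)) (hF : ContDiffAt ℝ ∞ F t)
    (hV : ContDiffAt ℝ ∞ V t) (hW : ContDiffAt ℝ ∞ W t) :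
    ∀ᶠ s in 𝓝 t, ∀ x, fderiv ℝ (fun s ↦ G (F s) (V s) (W s)) s x =
      G (F s) (alongDeriv Γ F V s x) (W s) + G (F s) (V s) (alongDeriv Γ F W s x) := by
  filter_upwards [eventually_differentiableAt hF, eventually_differentiableAt hV,
    eventually_differentiableAt hW, hF.continuousAt.eventually h.compatible,
    hF.continuousAt.eventually (eventually_differentiableAt h.smooth_metric)]
    with s hFs hVs hWs hc hG
  exact fderiv_metric_along hG hc hFs hVs hWs

lemma metric_alongDeriv_of_orthogonal (h : IsLocalLeviCivita G Γ (F t))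
    (hF : DifferentiableAt ℝ F t) (hV : DifferentiableAt ℝ V t) (hW : DifferentiableAt ℝ W t)
    (h0 : ∀ᶠ s in 𝓝 t, G (F s) (V s) (W s) = 0) (x : E) :
    G (F t) (alongDeriv Γ F V t x) (W t) = - G (F t) (V t) (alongDeriv Γ F W t x) := by
  have hconst : (fun s ↦ G (F s) (V s) (W s)) =ᶠ[𝓝 t] fun _ ↦ 0 := h0
  rw [eq_neg_iff_add_eq_zero, ← fderiv_metric_along (h.smooth_metric.differentiableAt (by simp))
    h.compatible.self_of_nhds hF hV hW, hconst.fderiv_eq]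
  simp

lemma localCurvature_bianchi {y : E'} (h : IsLocalLeviCivita G Γ y) (c b a : E') :
    localCurvature Γ y c b a + localCurvature Γ y b a c + localCurvature Γ y a c b = 0 := by
  have hsymm' : ∀ u v w, fderiv ℝ Γ y u v w = fderiv ℝ Γ y u w v := by
    intro u v w
    have hΓ : DifferentiableAt ℝ Γ y := h.smooth_symbols.differentiableAt (by simp)
    have hsymm : (fun s ↦ Γ s v w) =ᶠ[𝓝 y] fun s ↦ Γ s w v := by
      filter_upwards [h.torsion_free] with s hs using hs v w
    have := congr($(hsymm.fderiv_eq (𝕜 := ℝ)) u)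
    rw [fderiv_clm_apply₂ hΓ (differentiableAt_const v) (differentiableAt_const w),
      fderiv_clm_apply₂ hΓ (differentiableAt_const w) (differentiableAt_const v)] at this
    simpa using this
  have hsymm := h.torsion_free.self_of_nhds
  simp only [localCurvature]
  rw [hsymm' c a b, hsymm' b c a, hsymm' a b c, hsymm a b, hsymm b c, hsymm c a]
  abel

lemma fderiv_fderiv_metric_along (h : IsLocalLeviCivita G Γ (F t)) (hF : ContDiffAt ℝ ∞ F t)
    (hV : ContDiffAt ℝ ∞ V t) (hW : ContDiffAt ℝ ∞ W t) (x y : E) :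
    fderiv ℝ (fderiv ℝ (fun s ↦ G (F s) (V s) (W s))) t x y =
      G (F t) (alongDeriv Γ F (fun s ↦ alongDeriv Γ F V s y) t x) (W t) +
      G (F t) (alongDeriv Γ F V t y) (alongDeriv Γ F W t x) +
      (G (F t) (alongDeriv Γ F V t x) (alongDeriv Γ F W t y) +
      G (F t) (V t) (alongDeriv Γ F (fun s ↦ alongDeriv Γ F W s y) t x)) := by
  have hG := h.smooth_metric.differentiableAt (by simp)
  have hc := h.compatible.self_of_nhds
  have hF' : DifferentiableAt ℝ F t := hF.differentiableAt (by simp)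
  have hV' : DifferentiableAt ℝ V t := hV.differentiableAt (by simp)
  have hW' : DifferentiableAt ℝ W t := hW.differentiableAt (by simp)
  have hGF : ContDiffAt ℝ ∞ (fun s ↦ G (F s)) t := h.smooth_metric.comp t hF
  have hDV : ContDiffAt ℝ ∞ (fun s ↦ alongDeriv Γ F V s y) t :=
    contDiffAt_alongDeriv h.smooth_symbols hF hV contDiffAt_const
  have hDW : ContDiffAt ℝ ∞ (fun s ↦ alongDeriv Γ F W s y) t :=
    contDiffAt_alongDeriv h.smooth_symbols hF hW contDiffAt_const
  have hDV' := hDV.differentiableAt (by simp)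
  have hDW' := hDW.differentiableAt (by simp)
  have hdiff : DifferentiableAt ℝ (fderiv ℝ (fun s ↦ G (F s) (V s) (W s))) t :=
    (contDiffAt_fderiv ((hGF.clm_apply hV).clm_apply hW)).differentiableAt (by simp)
  have hfirst : (fun s ↦ fderiv ℝ (fun s ↦ G (F s) (V s) (W s)) s y) =ᶠ[𝓝 t] fun s ↦
      G (F s) (alongDeriv Γ F V s y) (W s) + G (F s) (V s) (alongDeriv Γ F W s y) :=
    (h.eventually_fderiv_metric_along hF hV hW).mono fun s hs ↦ hs y
  calc
    _ = fderiv ℝ (fun s ↦ fderiv ℝ (fun s ↦ G (F s) (V s) (W s)) s y) t x := by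
      simp [fderiv_clm_apply hdiff (differentiableAt_const y)]
    _ = fderiv ℝ (fun s ↦ G (F s) (alongDeriv Γ F V s y) (W s)) t x +
        fderiv ℝ (fun s ↦ G (F s) (V s) (alongDeriv Γ F W s y)) t x := by
      rw [hfirst.fderiv_eq, fderiv_fun_add
        (((hGF.clm_apply hDV).clm_apply hW).differentiableAt (by simp))
        (((hGF.clm_apply hV).clm_apply hDW).differentiableAt (by simp)), add_apply]
    _ = _ := by
      rw [fderiv_metric_along hG hc hF' hDV' hW', fderiv_metric_along hG hc hF' hV' hDW']

/- The second derivative of `G a b` is symmetric; expanding it by metric compatibility turns the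
antisymmetrization into `G (R(c, v) a) b + G a (R(c, v) b)`. -/
lemma localCurvature_skew {y : E'} (h : IsLocalLeviCivita G Γ y) (c v a b : E') :
    G y (localCurvature Γ y c v a) b = - G y (localCurvature Γ y c v b) a := by
  have hΓ : DifferentiableAt ℝ Γ y := h.smooth_symbols.differentiableAt (by simp)
  have hR : ∀ a, alongDeriv Γ id (fun s ↦ alongDeriv Γ id (fun _ ↦ a) s v) y c -
      alongDeriv Γ id (fun s ↦ alongDeriv Γ id (fun _ ↦ a) s c) y v = localCurvature Γ y c v a := by
    intro a
    simpa [alongDeriv] using alongDeriv_commutator (F := id) (t := y) hΓ contDiffAt_id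
      (contDiffAt_const (c := a)) (differentiableAt_const c) (differentiableAt_const v)
  have hsecond := h.fderiv_fderiv_metric_along (F := id) (t := y) contDiffAt_id
    (contDiffAt_const (c := a)) (contDiffAt_const (c := b))
  have hsymm := fderiv_fderiv_symm (((h.smooth_metric.comp y contDiffAt_id).clm_apply
    (contDiffAt_const (c := a))).clm_apply (contDiffAt_const (c := b))) c v
  simp only [Function.comp_apply] at hsymm
  rw [hsecond, hsecond] at hsymm
  rw [h.metric_symm y _ a, ← hR, ← hR]
  simp only [id, map_sub, sub_apply] at hsymm ⊢
  linarith

lemma metric_localHessian_eq_neg {k : E'' → E} {s₀ : E''}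
    (h : IsLocalLeviCivita G Γ (F (k s₀))) (hF : ContDiffAt ℝ ∞ F (k s₀))
    (hk : ContDiffAt ℝ ∞ k s₀)
    (h0 : ∀ᶠ s in 𝓝 s₀, ∀ v y, G (F (k s)) (fderiv ℝ F (k s) (fderiv ℝ k s v))
      (fderiv ℝ F (k s) y) = 0) (v w : E'') (y : E) :
    G (F (k s₀)) (localHessian Γ F (k s₀) (fderiv ℝ k s₀ w) y)
        (fderiv ℝ F (k s₀) (fderiv ℝ k s₀ v)) =
      - G (F (k s₀)) (localHessian Γ (F ∘ k) s₀ w v) (fderiv ℝ F (k s₀) y) := by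
  have hFk : ContDiffAt ℝ ∞ (F ∘ k) s₀ := hF.comp s₀ hk
  have hF' : DifferentiableAt ℝ F (k s₀) := hF.differentiableAt (by simp)
  have hk' : DifferentiableAt ℝ k s₀ := hk.differentiableAt (by simp)
  have hdFy : DifferentiableAt ℝ (fun s ↦ fderiv ℝ F s y) (k s₀) :=
    ((contDiffAt_fderiv hF).differentiableAt (by simp)).clm_apply (differentiableAt_const y)
  have hdFk : DifferentiableAt ℝ (fun s ↦ fderiv ℝ (F ∘ k) s v) s₀ :=
    ((contDiffAt_fderiv hFk).differentiableAt (by simp)).clm_apply (differentiableAt_const v)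
  have hchain : ∀ᶠ s in 𝓝 s₀, fderiv ℝ (F ∘ k) s = (fderiv ℝ F (k s)).comp (fderiv ℝ k s) := by
    filter_upwards [eventually_differentiableAt hk,
      hk.continuousAt.eventually (eventually_differentiableAt hF)] with s hs hs'
    exact fderiv_comp s hs' hs
  have horth : ∀ᶠ s in 𝓝 s₀, G ((F ∘ k) s) (fderiv ℝ (F ∘ k) s v)
      (((fun t ↦ fderiv ℝ F t y) ∘ k) s) = 0 := by
    filter_upwards [h0, hchain] with s hs hs'
    rw [hs']
    exact hs v y
  have hderiv := metric_alongDeriv_of_orthogonal (F := F ∘ k) h (hFk.differentiableAt (by simp))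
    hdFk (hdFy.comp s₀ hk') horth w
  rw [alongDeriv_fderiv_apply hFk (differentiableAt_const v), alongDeriv_comp hF' hdFy hk',
    alongDeriv_fderiv_apply hF (differentiableAt_const y), hchain.self_of_nhds] at hderiv
  simp only [fderiv_fun_const, Pi.zero_apply, zero_apply, map_zero, add_zero, Function.comp_apply,
    ContinuousLinearMap.comp_apply] at hderiv
  rw [hderiv, neg_neg, h.metric_symm]

lemma metric_localHessian_leaf_symm {k : E'' → E} {s₀ : E''}
    (h : IsLocalLeviCivita G Γ (F (k s₀))) (hF : ContDiffAt ℝ ∞ F (k s₀))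
    (hk : ContDiffAt ℝ ∞ k s₀)
    (h0 : ∀ᶠ s in 𝓝 s₀, ∀ v y, G (F (k s)) (fderiv ℝ F (k s) (fderiv ℝ k s v))
      (fderiv ℝ F (k s) y) = 0) (v w : E'') (y : E) :
    G (F (k s₀)) (localHessian Γ F (k s₀) (fderiv ℝ k s₀ v) y)
        (fderiv ℝ F (k s₀) (fderiv ℝ k s₀ w)) =
      G (F (k s₀)) (localHessian Γ F (k s₀) (fderiv ℝ k s₀ w) y)
        (fderiv ℝ F (k s₀) (fderiv ℝ k s₀ v)) := by
  rw [h.metric_localHessian_eq_neg hF hk h0, h.metric_localHessian_eq_neg hF hk h0,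
    localHessian_symm (F := F ∘ k) h (hF.comp s₀ hk)]

end IsLocalLeviCivita

end LocalCalculus

section TangentCoordinates

open Filter Topology Bundle

variable {E : Type*} [NormedAddCommGroup E] [NormedSpace ℝ E]
  {H : Type*} [TopologicalSpace H] {I : ModelWithCorners ℝ E H}
  {M : Type*} [TopologicalSpace M] [ChartedSpace H M]
  {W W' : Type*} [NormedAddCommGroup W] [NormedSpace ℝ W] [NormedAddCommGroup W'] [NormedSpace ℝ W']

lemma eventually_mem_chart_source {x₀ x : M} (hx : x ∈ (chartAt H x₀).source) :
    ∀ᶠ y in 𝓝 x, y ∈ (chartAt H x₀).source :=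
  (chartAt H x₀).open_source.mem_nhds hx

lemma eventually_extChartAt_symm {P : M → Prop} {u : M} (h : ∀ᶠ q in 𝓝 u, P q) :
    ∀ᶠ t in 𝓝 (extChartAt I u u), P ((extChartAt I u).symm t) := by
  have hc : Tendsto (extChartAt I u).symm (𝓝 (extChartAt I u u)) (𝓝 u) := by
    simpa only [ContinuousAt, extChartAt_to_inv] using continuousAt_extChartAt_symm (I := I) u
  exact hc.eventually h

lemma eventually_extChartAt {P : E → Prop} {u : M}
    (h : ∀ᶠ t in 𝓝 (extChartAt I u u), P t) : ∀ᶠ q in 𝓝 u, P (extChartAt I u q) :=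
  (continuousAt_extChartAt (I := I) u).eventually h

lemma eventually_of_eventually_extChartAt [I.Boundaryless] {P : E → Prop} {u : M}
    (h : ∀ᶠ q in 𝓝 u, P (extChartAt I u q)) : ∀ᶠ t in 𝓝 (extChartAt I u u), P t := by
  filter_upwards [eventually_extChartAt_symm h, extChartAt_target_mem_nhds (I := I) u]
    with t ht ht'
  rwa [(extChartAt I u).right_inv ht'] at ht

lemma mvfderiv_congr {a b : M → W} {q : M} (h : a =ᶠ[𝓝 q] b) (x : TangentSpace I q) :
    mvfderiv I a q x = mvfderiv I b q x := by
  have e : (mfderiv I 𝓘(ℝ, W) a q x : W) = mfderiv I 𝓘(ℝ, W) b q x :=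
    congr($(h.mfderiv_eq (I := I) (I' := 𝓘(ℝ, W))) x)
  exact e

variable [IsManifold I ∞ M]

lemma contDiffAt_chart [I.Boundaryless] {a : M → W} {x₀ : M} (ha : ContMDiffAt I 𝓘(ℝ, W) ∞ a x₀) :
    ContDiffAt ℝ ∞ (a ∘ (extChartAt I x₀).symm) (extChartAt I x₀ x₀) := by
  have h := contMDiffWithinAt_extChartAt_symm_range (I := I) (n := ∞) x₀
    (mem_extChartAt_target (I := I) x₀)
  rw [I.range_eq_univ, contMDiffWithinAt_univ] at h
  rw [← contMDiffAt_iff_contDiffAt]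
  exact ContMDiffAt.comp_of_eq ha h (by simp)

lemma mdifferentiableAt_of_chart {a : M → W} {x₀ x : M} (hx : x ∈ (chartAt H x₀).source)
    (ha : DifferentiableAt ℝ (a ∘ (extChartAt I x₀).symm) (extChartAt I x₀ x)) :
    MDifferentiableAt I 𝓘(ℝ, W) a x := by
  have h1 : MDifferentiableAt I 𝓘(ℝ, E) (extChartAt I x₀) x := mdifferentiableAt_extChartAt hx
  refine (ha.mdifferentiableAt.comp x h1).congr_of_eventuallyEq ?_
  filter_upwards [eventually_mem_chart_source hx] with y hy
  exact congrArg a ((extChartAt I x₀).left_inv (by simpa using hy)).symm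

variable (I) in
/-- The components of tangent vectors at `x` in the chart at `x₀`; junk unless `x` lies in the
domain of that chart. -/
noncomputable def coord (x₀ x : M) : TangentSpace I x →L[ℝ] E :=
  (trivializationAt E (TangentSpace I : M → Type _) x₀).continuousLinearMapAt ℝ x

variable (I) in
/-- The tangent vector at `x` with given components in the chart at `x₀`; it is `0` unless `x` lies
in the domain of that chart. -/
noncomputable def ofCoord (x₀ x : M) : E →L[ℝ] TangentSpace I x :=
  (trivializationAt E (TangentSpace I : M → Type _) x₀).symmL ℝ x

lemma coord_apply {x₀ x : M} (hx : x ∈ (chartAt H x₀).source) (v : TangentSpace I x) :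
    coord I x₀ x v = (trivializationAt E (TangentSpace I : M → Type _) x₀ ⟨x, v⟩).2 :=
  Trivialization.continuousLinearMapAt_apply_of_mem ℝ _ hx v

lemma ofCoord_apply {x₀ x : M} (hx : x ∈ (chartAt H x₀).source) (v : E) :
    ofCoord I x₀ x v = (trivializationAt E (TangentSpace I : M → Type _) x₀).symm x v :=
  Trivialization.symmL_apply _ hx v

@[simp]
lemma coord_ofCoord {x₀ x : M} (hx : x ∈ (chartAt H x₀).source) (v : E) :
    coord I x₀ x (ofCoord I x₀ x v) = v :=
  Trivialization.continuousLinearMapAt_symmL _ hx v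

@[simp]
lemma ofCoord_coord {x₀ x : M} (hx : x ∈ (chartAt H x₀).source) (v : TangentSpace I x) :
    ofCoord I x₀ x (coord I x₀ x v) = v :=
  Trivialization.symmL_continuousLinearMapAt _ hx v

lemma coord_injective {x₀ x : M} (hx : x ∈ (chartAt H x₀).source) :
    Function.Injective (coord I x₀ x) :=
  Function.LeftInverse.injective (ofCoord_coord hx)

lemma coord_eq_mfderiv {x₀ x : M} (hx : x ∈ (chartAt H x₀).source) :
    coord I x₀ x = mfderiv I 𝓘(ℝ, E) (extChartAt I x₀) x :=
  TangentBundle.continuousLinearMapAt_trivializationAt hx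

lemma ofCoord_eq_mfderivWithin {x₀ x : M} (hx : x ∈ (chartAt H x₀).source) :
    ofCoord I x₀ x = mfderivWithin 𝓘(ℝ, E) I (extChartAt I x₀).symm (Set.range I)
      (extChartAt I x₀ x) :=
  TangentBundle.symmL_trivializationAt hx

lemma extend_eq_ofCoord {x y : M} (hy : y ∈ (chartAt H x).source) (v : TangentSpace I x) :
    FiberBundle.extend E v y = ofCoord I x y (coord I x x v) := by
  rw [coord_apply (mem_chart_source H x), ofCoord_apply hy]
  rfl

lemma hasFDerivAt_chart [I.Boundaryless] {a : M → W} {x₀ x : M} (hx : x ∈ (chartAt H x₀).source)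
    (ha : MDifferentiableAt I 𝓘(ℝ, W) a x) :
    HasFDerivAt (a ∘ (extChartAt I x₀).symm) (mvfderiv I a x ∘L ofCoord I x₀ x)
      (extChartAt I x₀ x) := by
  have hx' : x ∈ (extChartAt I x₀).source := by simpa using hx
  have hsymm : HasMFDerivAt 𝓘(ℝ, E) I (extChartAt I x₀).symm (extChartAt I x₀ x)
      (ofCoord I x₀ x) := by
    rw [ofCoord_eq_mfderivWithin hx, I.range_eq_univ, mfderivWithin_univ]
    have h := mdifferentiableWithinAt_extChartAt_symm (I := I) ((extChartAt I x₀).map_source hx')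
    rw [I.range_eq_univ, mdifferentiableWithinAt_univ] at h
    exact h.hasMFDerivAt
  have ha' : HasMFDerivAt I 𝓘(ℝ, W) a ((extChartAt I x₀).symm (extChartAt I x₀ x))
      (mfderiv I 𝓘(ℝ, W) a x) := by
    rw [(extChartAt I x₀).left_inv hx']
    exact ha.hasMFDerivAt
  exact (HasMFDerivAt.comp (extChartAt I x₀ x) ha' hsymm).hasFDerivAt

lemma mvfderiv_eq_fderiv [I.Boundaryless] {a : M → W} {x₀ x : M}
    (hx : x ∈ (chartAt H x₀).source)
    (ha : MDifferentiableAt I 𝓘(ℝ, W) a x) (v : TangentSpace I x) :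
    mvfderiv I a x v =
      fderiv ℝ (a ∘ (extChartAt I x₀).symm) (extChartAt I x₀ x) (coord I x₀ x v) := by
  rw [(hasFDerivAt_chart hx ha).fderiv, ContinuousLinearMap.comp_apply, ofCoord_coord hx]

lemma mvfderiv_clm_apply [I.Boundaryless] {A : M → W →L[ℝ] W'} {a : M → W} {q : M}
    (hA : MDifferentiableAt I 𝓘(ℝ, W →L[ℝ] W') A q) (ha : MDifferentiableAt I 𝓘(ℝ, W) a q)
    (x : TangentSpace I q) :
    mvfderiv I (fun p ↦ A p (a p)) q x = mvfderiv I A q x (a q) + A q (mvfderiv I a q x) := by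
  have hq := mem_chart_source H q
  have hderiv := fderiv_clm_apply (hasFDerivAt_chart hq hA).differentiableAt
    (hasFDerivAt_chart hq ha).differentiableAt
  rw [mvfderiv_eq_fderiv hq (hA.clm_apply ha), mvfderiv_eq_fderiv hq hA,
    mvfderiv_eq_fderiv hq ha]
  refine congr($hderiv (coord I q q x)).trans ?_
  simp only [add_apply, ContinuousLinearMap.comp_apply, ContinuousLinearMap.flip_apply,
    Function.comp_apply, extChartAt_to_inv]
  abel

lemma mdifferentiableAt_field_iff {X : Π x : M, TangentSpace I x} {x₀ x : M}
    (hx : x ∈ (chartAt H x₀).source) :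
    MDifferentiableAt I I.tangent (fun y ↦ (⟨y, X y⟩ : TangentBundle I M)) x ↔
      MDifferentiableAt I 𝓘(ℝ, E) (fun y ↦ coord I x₀ y (X y)) x := by
  have h := (trivializationAt E (TangentSpace I : M → Type _) x₀).mdifferentiableAt_section_iff
    I X (b₀ := x) hx
  refine h.trans (Filter.EventuallyEq.mdifferentiableAt_iff ?_)
  filter_upwards [eventually_mem_chart_source hx] with y hy
  rw [coord_apply hy]

lemma contMDiffOn_ofCoord (x₀ : M) (w : E) :
    ContMDiffOn I I.tangent ∞ (fun y ↦ (⟨y, ofCoord I x₀ y w⟩ : TangentBundle I M))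
      (chartAt H x₀).source := by
  have h := (trivializationAt E (TangentSpace I : M → Type _) x₀).contMDiffOn_section_baseSet_iff
    (n := ∞) (IB := I) (s := fun y ↦ ofCoord I x₀ y w)
  refine h.2 ((contMDiffOn_const (c := w)).congr fun y hy ↦ ?_)
  exact (coord_apply hy _).symm.trans (coord_ofCoord hy w)

lemma mdifferentiableAt_ofCoord {x₀ x : M} (hx : x ∈ (chartAt H x₀).source) (w : E) :
    MDifferentiableAt I I.tangent (fun y ↦ (⟨y, ofCoord I x₀ y w⟩ : TangentBundle I M)) x :=
  ((contMDiffOn_ofCoord x₀ w).contMDiffAt (eventually_mem_chart_source hx)).mdifferentiableAt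
    (by simp)

lemma mdifferentiableAt_coordChange {z₀ z : M} (hz : z ∈ (chartAt H z₀).source) :
    MDifferentiableAt I 𝓘(ℝ, E →L[ℝ] E) (fun y ↦ (coord I z y ∘L ofCoord I z₀ y : E →L[ℝ] E))
      z := by
  have h := contMDiffOn_coordChangeL (IB := I) (n := 1)
    (trivializationAt E (TangentSpace I : M → Type _) z₀)
    (trivializationAt E (TangentSpace I : M → Type _) z)
  have hU : (chartAt H z₀).source ∩ (chartAt H z).source ∈ 𝓝 z :=
    ((chartAt H z₀).open_source.inter (chartAt H z).open_source).mem_nhds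
      ⟨hz, mem_chart_source H z⟩
  refine ((h.contMDiffAt hU).mdifferentiableAt (by simp)).congr_of_eventuallyEq ?_
  filter_upwards [hU] with y hy
  ext w
  rw [ContinuousLinearMap.comp_apply, coord_apply hy.2, ofCoord_apply hy.1]
  exact (Trivialization.coordChangeL_apply _ _ hy w).symm

variable (I) in
/-- The components of a vector field in the chart at `u`. -/
noncomputable def localField (X : Π q : M, TangentSpace I q) (u : M) (t : E) : E :=
  coord I u ((extChartAt I u).symm t) (X ((extChartAt I u).symm t))

lemma localField_apply (X : Π q : M, TangentSpace I q) {u q : M} (hq : q ∈ (chartAt H u).source) :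
    localField I X u (extChartAt I u q) = coord I u q (X q) := by
  rw [localField, (extChartAt I u).left_inv (by rwa [extChartAt_source])]

lemma localField_self (X : Π q : M, TangentSpace I q) (u : M) :
    localField I X u (extChartAt I u u) = coord I u u (X u) :=
  localField_apply X (mem_chart_source H u)

lemma contDiffAt_localField [I.Boundaryless] {X : Π q : M, TangentSpace I q} {U : Set M} {u : M}
    (hX : SmoothFieldOn X U) (hU : U ∈ 𝓝 u) :
    ContDiffAt ℝ ∞ (localField I X u) (extChartAt I u u) := by
  have h := (contMDiffAt_totalSpace.1 (hX.contMDiffAt hU)).2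
  refine (contDiffAt_chart h).congr_of_eventuallyEq ?_
  filter_upwards [eventually_extChartAt_symm (eventually_mem_chart_source
    (mem_chart_source H u))] with t ht
  exact coord_apply ht _

lemma contDiffAt_localField_extend [I.Boundaryless] [T2Space M] (z : M) (v : TangentSpace I z) :
    ContDiffAt ℝ ∞ (localField I (FiberBundle.extend E v) z) (extChartAt I z z) := by
  obtain ⟨U, hU, h⟩ := FiberBundle.exists_contMDiffOn_extend (k := ∞) I E v
  exact contDiffAt_localField h hU

lemma localField_ofCoord [I.Boundaryless] {x₀ x : M} (hx : x ∈ (chartAt H x₀).source) (w : E) :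
    localField I (fun y ↦ ofCoord I x₀ y w) x₀ =ᶠ[𝓝 (extChartAt I x₀ x)] fun _ ↦ w := by
  filter_upwards [extChartAt_target_mem_nhds' (I := I)
    ((extChartAt I x₀).map_source (by simpa using hx))] with t ht
  exact coord_ofCoord (by simpa using (extChartAt I x₀).map_target ht) w

lemma eventuallyEq_mpullback_localField (X : Π x : M, TangentSpace I x) {x₀ x : M}
    (hx : x ∈ (chartAt H x₀).source) :
    X =ᶠ[𝓝 x] VectorField.mpullback I 𝓘(ℝ, E) (extChartAt I x₀)
      (localField I X x₀ : Π y : E, TangentSpace 𝓘(ℝ, E) y) := by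
  filter_upwards [eventually_mem_chart_source hx] with y hy
  have hy' : y ∈ (extChartAt I x₀).source := by simpa using hy
  have hcoord : mfderiv I 𝓘(ℝ, E) (extChartAt I x₀) y (X y) =
      localField I X x₀ (extChartAt I x₀ y) := by
    rw [localField_apply X hy, coord_eq_mfderiv hy]
    rfl
  exact ((isInvertible_mfderiv_extChartAt hy').inverse_apply_self (X y)).symm.trans
    (congrArg _ hcoord)

lemma mlieBracket_eq_lieBracket (X Y : Π y : E, TangentSpace 𝓘(ℝ, E) y) :
    VectorField.mlieBracket 𝓘(ℝ, E) X Y = VectorField.lieBracket ℝ X Y := by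
  rw [← VectorField.mlieBracketWithin_univ, VectorField.mlieBracketWithin_eq_lieBracketWithin]
  exact VectorField.lieBracketWithin_univ

lemma coord_mlieBracket [I.Boundaryless] [CompleteSpace E] {X Y : Π x : M, TangentSpace I x}
    {x₀ x : M} (hx : x ∈ (chartAt H x₀).source)
    (hX : DifferentiableAt ℝ (localField I X x₀) (extChartAt I x₀ x))
    (hY : DifferentiableAt ℝ (localField I Y x₀) (extChartAt I x₀ x)) :
    coord I x₀ x (VectorField.mlieBracket I X Y x) =
      fderiv ℝ (localField I Y x₀) (extChartAt I x₀ x) (localField I X x₀ (extChartAt I x₀ x)) -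
      fderiv ℝ (localField I X x₀) (extChartAt I x₀ x)
        (localField I Y x₀ (extChartAt I x₀ x)) := by
  have hmd : ∀ Z : Π y : E, TangentSpace 𝓘(ℝ, E) y,
      DifferentiableAt ℝ (Z : E → E) (extChartAt I x₀ x) →
      MDifferentiableAt 𝓘(ℝ, E) 𝓘(ℝ, E).tangent
        (fun y ↦ (⟨y, Z y⟩ : TangentBundle 𝓘(ℝ, E) E)) (extChartAt I x₀ x) := by
    intro Z hZ
    rw [mdifferentiableAt_section]
    simpa using hZ.mdifferentiableAt
  have hx' : x ∈ (extChartAt I x₀).source := by simpa using hx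
  have : IsManifold I (minSmoothness ℝ 2) M := IsManifold.of_le minSmoothness_two_le
  rw [(eventuallyEq_mpullback_localField X hx).mlieBracket_vectorField_eq
      (eventuallyEq_mpullback_localField Y hx),
    ← VectorField.mpullback_mlieBracket (n := ∞) (hmd _ hX) (hmd _ hY)
      (contMDiffAt_extChartAt' hx) minSmoothness_two_le,
    VectorField.mpullback_apply, coord_eq_mfderiv hx]
  refine ((isInvertible_mfderiv_extChartAt hx').self_apply_inverse _).trans ?_
  exact congrFun (mlieBracket_eq_lieBracket _ _) (extChartAt I x₀ x)

lemma mlieBracket_ofCoord [I.Boundaryless] [CompleteSpace E] {z₀ z : M}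
    (hz : z ∈ (chartAt H z₀).source) (v w : E) :
    VectorField.mlieBracket I (fun p ↦ ofCoord I z₀ p v) (fun p ↦ ofCoord I z₀ p w) z = 0 := by
  have hconst : ∀ w : E, DifferentiableAt ℝ (localField I (fun y ↦ ofCoord I z₀ y w) z₀)
      (extChartAt I z₀ z) := fun w ↦
    (differentiableAt_const w).congr_of_eventuallyEq (localField_ofCoord hz w)
  apply coord_injective hz
  rw [coord_mlieBracket hz (hconst v) (hconst w), (localField_ofCoord hz v).fderiv_eq,
    (localField_ofCoord hz w).fderiv_eq]
  simp

end TangentCoordinates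

section CovariantDerivativeCoordinates

open Filter Topology Bundle

variable {E : Type*} [NormedAddCommGroup E] [NormedSpace ℝ E]
  {H : Type*} [TopologicalSpace H] {I : ModelWithCorners ℝ E H}
  {M : Type*} [TopologicalSpace M] [ChartedSpace H M] [IsManifold I ∞ M]
  {E' : Type*} [NormedAddCommGroup E'] [NormedSpace ℝ E'] [FiniteDimensional ℝ E']
  {H' : Type*} [TopologicalSpace H'] {I' : ModelWithCorners ℝ E' H'}
  {N : Type*} [TopologicalSpace N] [ChartedSpace H' N] [IsManifold I' ∞ N]

omit [FiniteDimensional ℝ E'] in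
lemma tensorialAt_covariantDerivative_sub
    (nabla : CovariantDerivative I' E' (TangentSpace I' : N → Type _)) {z₀ z : N}
    (hz : z ∈ (chartAt H' z₀).source) :
    TensorialAt I' E' (fun τ : Π y : N, TangentSpace I' y ↦
      nabla τ z - ofCoord I' z₀ z ∘L mvfderiv I' (fun y ↦ coord I' z₀ y (τ y)) z) z where
  smul := by
    intro f τ hf hτ
    have hcoord : (fun y ↦ coord I' z₀ y ((f • τ) y)) = f • fun y ↦ coord I' z₀ y (τ y) := by
      ext y
      simp
    rw [nabla.isCovariantDerivativeOnUniv.leibniz hτ hf, hcoord,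
      mvfderiv_smul hf ((mdifferentiableAt_field_iff hz).1 hτ)]
    ext w
    simp [ofCoord_coord hz, smul_sub]
  add := by
    intro τ τ' hτ hτ'
    have hcoord : (fun y ↦ coord I' z₀ y ((τ + τ') y)) =
        (fun y ↦ coord I' z₀ y (τ y)) + fun y ↦ coord I' z₀ y (τ' y) := by
      ext y
      simp
    rw [nabla.isCovariantDerivativeOnUniv.add hτ hτ', hcoord,
      mvfderiv_add ((mdifferentiableAt_field_iff hz).1 hτ) ((mdifferentiableAt_field_iff hz).1 hτ')]
    ext w
    simp only [ContinuousLinearMap.comp_add, sub_apply, add_apply, ContinuousLinearMap.comp_apply]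
    abel

lemma covariantDerivative_eq (nabla : CovariantDerivative I' E' (TangentSpace I' : N → Type _))
    {σ : Π z : N, TangentSpace I' z} {z₀ z : N} (hz : z ∈ (chartAt H' z₀).source)
    (hσ : MDifferentiableAt I' I'.tangent (fun y ↦ (⟨y, σ y⟩ : TangentBundle I' N)) z)
    (v : TangentSpace I' z) :
    nabla σ z v = ofCoord I' z₀ z (mvfderiv I' (fun y ↦ coord I' z₀ y (σ y)) z v) +
      nabla (fun y ↦ ofCoord I' z₀ y (coord I' z₀ z (σ z))) z v := by
  have h := (tensorialAt_covariantDerivative_sub nabla hz).pointwise hσ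
    (mdifferentiableAt_ofCoord hz (coord I' z₀ z (σ z))) (ofCoord_coord hz (σ z)).symm
  have hconst : mvfderiv I' (fun y ↦ coord I' z₀ y (ofCoord I' z₀ y (coord I' z₀ z (σ z)))) z v =
      0 := by
    rw [mvfderiv_congr (b := fun _ ↦ coord I' z₀ z (σ z)), mvfderiv_const]
    · rfl
    · filter_upwards [eventually_mem_chart_source hz] with y hy using coord_ofCoord hy _
  have h' := congr($h v)
  rw [sub_apply, sub_apply, ContinuousLinearMap.comp_apply, ContinuousLinearMap.comp_apply, hconst,
    map_zero, sub_zero, sub_eq_iff_eq_add] at h'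
  rw [h', add_comm]

omit [FiniteDimensional ℝ E'] in
lemma covariantDerivative_extend
    (nabla : CovariantDerivative I' E' (TangentSpace I' : N → Type _)) {z : N}
    (v : TangentSpace I' z) :
    nabla (FiberBundle.extend E' v) z = nabla (fun y ↦ ofCoord I' z y (coord I' z z v)) z := by
  have hz := mem_chart_source H' z
  refine nabla.isCovariantDerivativeOnUniv.congr_of_eventuallyEq
    (FiberBundle.mdifferentiableAt_extend I' E' v) (mdifferentiableAt_ofCoord hz _)
    Filter.univ_mem ?_
  filter_upwards [eventually_mem_chart_source hz] with y hy using extend_eq_ofCoord hy v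

lemma covDerivAlong_eq [I.Boundaryless] [I'.Boundaryless]
    (nabla : CovariantDerivative I' E' (TangentSpace I' : N → Type _)) {f : M → N}
    {V : Π q : M, TangentSpace I' (f q)} {z₀ : N} {q : M}
    (hq : f q ∈ (chartAt H' z₀).source) (hf : MDifferentiableAt I I' f q)
    (hV : MDifferentiableAt I 𝓘(ℝ, E') (fun p ↦ coord I' z₀ (f p) (V p)) q)
    (x : TangentSpace I q) :
    covDerivAlong nabla f V q x =
      ofCoord I' z₀ (f q) (mvfderiv I (fun p ↦ coord I' z₀ (f p) (V p)) q x) +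
      nabla (fun z ↦ ofCoord I' z₀ z (coord I' z₀ (f q) (V q))) (f q) (mfderiv I I' f q x) := by
  have hz := mem_chart_source H' (f q)
  let C (z : N) : E' →L[ℝ] E' := coord I' (f q) z ∘L ofCoord I' z₀ z
  have hC : MDifferentiableAt I' 𝓘(ℝ, E' →L[ℝ] E') C (f q) := mdifferentiableAt_coordChange hq
  have hCf : MDifferentiableAt I 𝓘(ℝ, E' →L[ℝ] E') (C ∘ f) q := hC.comp q hf
  have hchange : mvfderiv I (fun p ↦ (trivializationAt E' (TangentSpace I' : N → Type _) (f q)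
        (⟨f p, V p⟩ : TangentBundle I' N)).2) q x =
      mvfderiv I (fun p ↦ (C ∘ f) p (coord I' z₀ (f p) (V p))) q x := by
    apply mvfderiv_congr
    filter_upwards [hf.continuousAt.eventually (eventually_mem_chart_source hq),
      hf.continuousAt.eventually (eventually_mem_chart_source hz)] with p hp hp'
    simp only [C, Function.comp_apply, ContinuousLinearMap.comp_apply]
    rw [ofCoord_coord hp, coord_apply hp']
  have hchange_const (w : E') (v : TangentSpace I' (f q)) :
      mvfderiv I' (fun y ↦ coord I' (f q) y (ofCoord I' z₀ y w)) (f q) v =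
        mvfderiv I' C (f q) v w := by
    have := mvfderiv_clm_apply hC (mdifferentiableAt_const (c := w)) v
    rw [mvfderiv_const] at this
    exact this.trans ((congrArg _ (map_zero _)).trans (add_zero _))
  have hcomp : mvfderiv I (C ∘ f) q x = mvfderiv I' C (f q) (mfderiv I I' f q x) :=
    mfderiv_comp_apply q hC hf x
  rw [covDerivAlong, hchange, mvfderiv_clm_apply hCf hV, hcomp, covariantDerivative_extend,
    covariantDerivative_eq nabla hz (mdifferentiableAt_ofCoord hq _), ofCoord_coord hq,
    ← ofCoord_apply hz, hchange_const, map_add, Function.comp_apply,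
    ContinuousLinearMap.comp_apply, ofCoord_coord hz]
  abel

end CovariantDerivativeCoordinates

section LocalLeviCivita

open Filter Topology Bundle

lemma contDiffAt_clm_of_apply {D V W : Type*} [NormedAddCommGroup D] [NormedSpace ℝ D]
    [NormedAddCommGroup V] [NormedSpace ℝ V] [FiniteDimensional ℝ V]
    [NormedAddCommGroup W] [NormedSpace ℝ W] {f : D → V →L[ℝ] W} {x : D} {n : ℕ∞ω}
    (h : ∀ v, ContDiffAt ℝ n (fun y ↦ f y v) x) : ContDiffAt ℝ n f x := by
  have hd : Module.finrank ℝ V = Module.finrank ℝ (Fin (Module.finrank ℝ V) → ℝ) :=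
    (Module.finrank_fin_fun ℝ).symm
  let e₁ := ContinuousLinearEquiv.ofFinrankEq hd
  let e₂ := (e₁.arrowCongr (1 : W ≃L[ℝ] W)).trans
    (ContinuousLinearEquiv.piRing (Fin (Module.finrank ℝ V)))
  rw [← Function.id_comp f, ← e₂.symm_comp_self]
  exact e₂.symm.contDiff.contDiffAt.comp x (contDiffAt_pi.mpr fun i ↦ h _)

/-- A bilinear map on a finite-dimensional space as a continuous bilinear map. -/
noncomputable def continuousBilinear {V W : Type*} [NormedAddCommGroup V] [NormedSpace ℝ V]
    [FiniteDimensional ℝ V] [NormedAddCommGroup W] [NormedSpace ℝ W] (B : V →ₗ[ℝ] V →ₗ[ℝ] W) :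
    V →L[ℝ] V →L[ℝ] W :=
  LinearMap.toContinuousLinearMap
    ((LinearMap.toContinuousLinearMap (𝕜 := ℝ) (E := V) (F' := W)).toLinearMap ∘ₗ B)

@[simp]
lemma continuousBilinear_apply {V W : Type*} [NormedAddCommGroup V] [NormedSpace ℝ V]
    [FiniteDimensional ℝ V] [NormedAddCommGroup W] [NormedSpace ℝ W] (B : V →ₗ[ℝ] V →ₗ[ℝ] W)
    (v w : V) : continuousBilinear B v w = B v w := rfl

variable {E : Type*} [NormedAddCommGroup E] [NormedSpace ℝ E] [FiniteDimensional ℝ E]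
  {H : Type*} [TopologicalSpace H] {I : ModelWithCorners ℝ E H}
  {M : Type*} [TopologicalSpace M] [ChartedSpace H M] [IsManifold I ∞ M]

/-- The components of the metric in the chart at `z₀`. -/
noncomputable def localMetric (g : SemiRiemannianMetric I M) (z₀ : M) (y : E) :
    E →L[ℝ] E →L[ℝ] ℝ :=
  let z := (extChartAt I z₀).symm y
  continuousBilinear ((g.val z).toBilinForm.compl₁₂ (ofCoord I z₀ z).toLinearMap
    (ofCoord I z₀ z).toLinearMap)

lemma localMetric_apply (g : SemiRiemannianMetric I M) (z₀ : M) (y v w : E) :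
    localMetric g z₀ y v w = g.val ((extChartAt I z₀).symm y)
      (ofCoord I z₀ _ v) (ofCoord I z₀ _ w) := rfl

lemma metric_eq_localMetric (g : SemiRiemannianMetric I M) {z₀ z : M}
    (hz : z ∈ (chartAt H z₀).source) (v w : TangentSpace I z) :
    g.val z v w = localMetric g z₀ (extChartAt I z₀ z) (coord I z₀ z v) (coord I z₀ z w) := by
  rw [localMetric_apply, (extChartAt I z₀).left_inv (by rwa [extChartAt_source]),
    ofCoord_coord hz, ofCoord_coord hz]

omit [FiniteDimensional ℝ E] in
lemma contMDiffAt_metric_ofCoord (g : SemiRiemannianMetric I M) (z₀ : M) (v w : E) :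
    ContMDiffAt I 𝓘(ℝ, ℝ) ∞ (fun z ↦ g.val z (ofCoord I z₀ z v) (ofCoord I z₀ z w)) z₀ := by
  have hU := eventually_mem_chart_source (mem_chart_source H z₀)
  have h : ContMDiffAt I (I.prod 𝓘(ℝ)) ∞ (fun z ↦ TotalSpace.mk' ℝ (E := Bundle.Trivial M ℝ) z
      (g.val z (ofCoord I z₀ z v) (ofCoord I z₀ z w))) z₀ :=
    ContMDiffAt.clm_bundle_apply₂ (F₁ := E) (F₂ := E) g.contMDiff.contMDiffAt
      ((contMDiffOn_ofCoord z₀ v).contMDiffAt hU) ((contMDiffOn_ofCoord z₀ w).contMDiffAt hU)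
  exact (contMDiffAt_totalSpace.1 h).2

lemma contDiffAt_localMetric [I.Boundaryless] (g : SemiRiemannianMetric I M) (z₀ : M) :
    ContDiffAt ℝ ∞ (localMetric g z₀) (extChartAt I z₀ z₀) :=
  contDiffAt_clm_of_apply fun v ↦ contDiffAt_clm_of_apply fun w ↦
    contDiffAt_chart (contMDiffAt_metric_ofCoord g z₀ v w)

open Classical in
/-- The Christoffel symbols of a covariant derivative in the chart at `z₀`: at the point `y` of the
model space, `Γ w v` is the derivative in the direction `v` of the coordinate field with components
`w`. They are set to `0` outside the domain of the chart, where this is not linear in `w`. -/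
noncomputable def christoffel (nabla : CovariantDerivative I E (TangentSpace I : M → Type _))
    (z₀ : M) (y : E) : E →L[ℝ] E →L[ℝ] E :=
  let z := (extChartAt I z₀).symm y
  if hz : z ∈ (chartAt H z₀).source then
    continuousBilinear <| LinearMap.mk₂ ℝ
      (fun w v ↦ coord I z₀ z (nabla (fun p ↦ ofCoord I z₀ p w) z (ofCoord I z₀ z v)))
      (fun w w' v ↦ by
        have e : (fun p ↦ ofCoord I z₀ p (w + w')) =
            (fun p ↦ ofCoord I z₀ p w) + fun p ↦ ofCoord I z₀ p w' := by
          ext p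
          simp
        rw [e, nabla.isCovariantDerivativeOnUniv.add (mdifferentiableAt_ofCoord hz w)
          (mdifferentiableAt_ofCoord hz w')]
        simp)
      (fun c w v ↦ by
        have e : (fun p ↦ ofCoord I z₀ p (c • w)) = c • fun p ↦ ofCoord I z₀ p w := by
          ext p
          simp
        rw [e, nabla.isCovariantDerivativeOnUniv.smul_const c (mdifferentiableAt_ofCoord hz w)]
        simp)
      (fun w v v' ↦ by simp)
      (fun c w v ↦ by simp)
  else 0

section Christoffel

variable {nabla : CovariantDerivative I E (TangentSpace I : M → Type _)}

lemma christoffel_apply {z₀ z : M} (hz : z ∈ (chartAt H z₀).source) (w : E)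
    (v : TangentSpace I z) :
    christoffel nabla z₀ (extChartAt I z₀ z) w (coord I z₀ z v) =
      coord I z₀ z (nabla (fun p ↦ ofCoord I z₀ p w) z v) := by
  have hz' : (extChartAt I z₀).symm (extChartAt I z₀ z) = z :=
    (extChartAt I z₀).left_inv (by rwa [extChartAt_source])
  simp only [christoffel]
  rw [dif_pos (by rwa [hz']), continuousBilinear_apply, LinearMap.mk₂_apply, hz',
    ofCoord_coord hz]

lemma contMDiffAt_covariantDerivative_ofCoord [I.Boundaryless] [T2Space M]
    (hn : CovariantDerivative.ContMDiffCovariantDerivative nabla ∞) (z₀ : M) (w v : E) :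
    ContMDiffAt I 𝓘(ℝ, E) ∞
      (fun z ↦ coord I z₀ z (nabla (fun p ↦ ofCoord I z₀ p w) z (ofCoord I z₀ z v))) z₀ := by
  have hU := eventually_mem_chart_source (mem_chart_source H z₀)
  obtain ⟨χ, -, -⟩ := (SmoothBumpFunction.nhds_basis_tsupport (I := I) z₀).mem_iff.1 hU
  set σ : Π z : M, TangentSpace I z := (χ : M → ℝ) • fun p ↦ ofCoord I z₀ p w
  have hσ : ContMDiff I I.tangent ∞ (fun z ↦ (⟨z, σ z⟩ : TangentBundle I M)) :=
    ContMDiffOn.smul_section_of_tsupport χ.contMDiff.contMDiffOn (chartAt H z₀).open_source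
      χ.tsupport_subset_chartAt_source (contMDiffOn_ofCoord z₀ w)
  have hnabla : ContMDiff I (I.prod 𝓘(ℝ, E →L[ℝ] E)) ∞ (fun z ↦ (⟨z, nabla σ z⟩ :
      TotalSpace (E →L[ℝ] E) fun x : M ↦ TangentSpace I x →L[ℝ] TangentSpace I x)) :=
    contMDiffOn_univ.1 (hn.contMDiff.contMDiff (by simpa using hσ.contMDiffOn))
  have happly : ContMDiffAt I I.tangent ∞
      (fun z ↦ (⟨z, nabla σ z (ofCoord I z₀ z v)⟩ : TangentBundle I M)) z₀ :=
    ContMDiffAt.clm_bundle_apply (F₁ := E) (F₂ := E) hnabla.contMDiffAt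
      ((contMDiffOn_ofCoord z₀ v).contMDiffAt hU)
  refine (contMDiffAt_totalSpace.1 happly).2.congr_of_eventuallyEq ?_
  filter_upwards [hU, χ.eventuallyEq_one.eventually_nhds] with z hz hχ
  rw [coord_apply hz, nabla.isCovariantDerivativeOnUniv.congr_of_eventuallyEq
    (mdifferentiableAt_ofCoord hz w) (hσ.contMDiffAt.mdifferentiableAt (by simp))
    Filter.univ_mem]
  filter_upwards [hχ] with p hp
  simp [σ, hp]

lemma contDiffAt_christoffel [I.Boundaryless] [T2Space M]
    (hn : CovariantDerivative.ContMDiffCovariantDerivative nabla ∞) (z₀ : M) :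
    ContDiffAt ℝ ∞ (christoffel nabla z₀) (extChartAt I z₀ z₀) := by
  refine contDiffAt_clm_of_apply fun w ↦ contDiffAt_clm_of_apply fun v ↦ ?_
  have hfield := contMDiffAt_covariantDerivative_ofCoord hn z₀ w v
  refine (contDiffAt_chart hfield).congr_of_eventuallyEq (eventually_of_eventually_extChartAt ?_)
  filter_upwards [eventually_mem_chart_source (mem_chart_source H z₀)] with z hz
  rw [Function.comp_apply, (extChartAt I z₀).left_inv (by rwa [extChartAt_source]),
    ← christoffel_apply hz, coord_ofCoord hz]

lemma christoffel_symm [I.Boundaryless] (h : nabla.torsion = 0) {z₀ z : M}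
    (hz : z ∈ (chartAt H z₀).source) (v w : E) :
    christoffel nabla z₀ (extChartAt I z₀ z) v w =
      christoffel nabla z₀ (extChartAt I z₀ z) w v := by
  have : CompleteSpace E := FiniteDimensional.complete ℝ E
  have htorsion := (CovariantDerivative.torsion_eq_zero_iff nabla).1 h
    (mdifferentiableAt_ofCoord hz w) (mdifferentiableAt_ofCoord hz v)
  rw [mlieBracket_ofCoord hz, sub_eq_zero] at htorsion
  simpa only [← christoffel_apply hz, coord_ofCoord hz] using congrArg (coord I z₀ z) htorsion

lemma fderiv_localMetric [I.Boundaryless] {g : SemiRiemannianMetric I M}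
    (h : g.IsLeviCivita nabla) {z₀ z : M} (hz : z ∈ (chartAt H z₀).source)
    (hg : DifferentiableAt ℝ (localMetric g z₀) (extChartAt I z₀ z)) (v a b : E) :
    fderiv ℝ (localMetric g z₀) (extChartAt I z₀ z) v a b =
      localMetric g z₀ (extChartAt I z₀ z) (christoffel nabla z₀ (extChartAt I z₀ z) a v) b +
      localMetric g z₀ (extChartAt I z₀ z) a (christoffel nabla z₀ (extChartAt I z₀ z) b v) := by
  have hmetric := h.metric z (ofCoord I z₀ z v) _ _ (mdifferentiableAt_ofCoord hz a)
    (mdifferentiableAt_ofCoord hz b)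
  have hd : DifferentiableAt ℝ (fun y ↦ localMetric g z₀ y a b) (extChartAt I z₀ z) :=
    (hg.clm_apply (differentiableAt_const a)).clm_apply (differentiableAt_const b)
  have hcoord : mvfderiv I (fun p ↦ g.val p (ofCoord I z₀ p a) (ofCoord I z₀ p b)) z
      (ofCoord I z₀ z v) = fderiv ℝ (fun y ↦ localMetric g z₀ y a b) (extChartAt I z₀ z) v := by
    rw [mvfderiv_eq_fderiv hz (mdifferentiableAt_of_chart hz hd), coord_ofCoord hz]
    rfl
  have hconst := fderiv_clm_apply₂ hg (differentiableAt_const a) (differentiableAt_const b) v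
  simp only [fderiv_fun_const, Pi.zero_apply, zero_apply, map_zero, add_zero] at hconst
  rw [← hconst, ← hcoord, hmetric, metric_eq_localMetric g hz, metric_eq_localMetric g hz,
    ← christoffel_apply hz, ← christoffel_apply hz, coord_ofCoord hz, coord_ofCoord hz,
    coord_ofCoord hz]

theorem isLocalLeviCivita [I.Boundaryless] [T2Space M] {g : SemiRiemannianMetric I M}
    (h : g.IsLeviCivita nabla) (z₀ : M) :
    IsLocalLeviCivita (localMetric g z₀) (christoffel nabla z₀) (extChartAt I z₀ z₀) where
  smooth_metric := contDiffAt_localMetric g z₀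
  smooth_symbols := contDiffAt_christoffel h.smooth z₀
  metric_symm y v w := by rw [localMetric_apply, localMetric_apply, g.symm]
  torsion_free := by
    refine eventually_of_eventually_extChartAt ?_
    filter_upwards [eventually_mem_chart_source (mem_chart_source H z₀)] with z hz v w using
      christoffel_symm h.torsion_free hz v w
  compatible := by
    refine eventually_of_eventually_extChartAt ?_
    filter_upwards [eventually_mem_chart_source (mem_chart_source H z₀),
      eventually_extChartAt (eventually_differentiableAt (contDiffAt_localMetric g z₀))]
      with z hz hg v a b using fderiv_localMetric h hz hg v a b

lemma coord_covariantDerivative [I.Boundaryless] {σ : Π z : M, TangentSpace I z} {z₀ z : M}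
    (hz : z ∈ (chartAt H z₀).source)
    (hσ : DifferentiableAt ℝ (localField I σ z₀) (extChartAt I z₀ z)) (v : TangentSpace I z) :
    coord I z₀ z (nabla σ z v) = alongDeriv (christoffel nabla z₀) id (localField I σ z₀)
      (extChartAt I z₀ z) (coord I z₀ z v) := by
  have hσ' : MDifferentiableAt I 𝓘(ℝ, E) (fun y ↦ coord I z₀ y (σ y)) z :=
    mdifferentiableAt_of_chart hz hσ
  rw [covariantDerivative_eq nabla hz ((mdifferentiableAt_field_iff hz).2 hσ'), map_add,
    coord_ofCoord hz, ← christoffel_apply hz, mvfderiv_eq_fderiv hz hσ', alongDeriv, fderiv_id,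
    localField_apply σ hz]
  rfl

lemma localField_covariantDerivative [I.Boundaryless] {σ : Π z : M, TangentSpace I z} {z₀ : M}
    (hσ : ContDiffAt ℝ ∞ (localField I σ z₀) (extChartAt I z₀ z₀))
    (Y : Π z : M, TangentSpace I z) :
    localField I (fun y ↦ nabla σ y (Y y)) z₀ =ᶠ[𝓝 (extChartAt I z₀ z₀)] fun t ↦
      alongDeriv (christoffel nabla z₀) id (localField I σ z₀) t (localField I Y z₀ t) := by
  refine eventually_of_eventually_extChartAt ?_
  filter_upwards [eventually_mem_chart_source (mem_chart_source H z₀),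
    eventually_extChartAt (eventually_differentiableAt hσ)] with z hz hd
  rw [localField_apply _ hz, localField_apply _ hz, coord_covariantDerivative hz hd]

lemma coord_curvature [I.Boundaryless] [T2Space M]
    (hn : CovariantDerivative.ContMDiffCovariantDerivative nabla ∞) {z : M}
    {X Y Z : Π y : M, TangentSpace I y}
    (hX : ContDiffAt ℝ ∞ (localField I X z) (extChartAt I z z))
    (hY : ContDiffAt ℝ ∞ (localField I Y z) (extChartAt I z z))
    (hZ : ContDiffAt ℝ ∞ (localField I Z z) (extChartAt I z z)) :
    coord I z z (curvature (fun X Y y ↦ nabla Y y (X y)) X Y Z z) =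
      localCurvature (christoffel nabla z) (extChartAt I z z) (coord I z z (X z))
        (coord I z z (Y z)) (coord I z z (Z z)) := by
  have : CompleteSpace E := FiniteDimensional.complete ℝ E
  have hz := mem_chart_source H z
  have hΓ : ContDiffAt ℝ ∞ (christoffel nabla z) (id (extChartAt I z z)) :=
    contDiffAt_christoffel hn z
  have hX' := hX.differentiableAt (by simp)
  have hY' := hY.differentiableAt (by simp)
  have derivative {V : Π y : M, TangentSpace I y}
      (hV : ContDiffAt ℝ ∞ (localField I V z) (extChartAt I z z)) : DifferentiableAt ℝ
      (localField I (fun y ↦ nabla Z y (V y)) z) (extChartAt I z z) :=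
    ((contDiffAt_alongDeriv hΓ contDiffAt_id hZ hV).congr_of_eventuallyEq
      (localField_covariantDerivative hZ V)).differentiableAt (by simp)
  have commutator := alongDeriv_commutator (F := id) (hΓ.differentiableAt (by simp)) contDiffAt_id
    hZ hX' hY'
  rw [← coord_mlieBracket hz hX' hY', localField_self, localField_self, localField_self]
    at commutator
  simp only [fderiv_id, ContinuousLinearMap.id_apply, id_eq] at commutator
  rw [← commutator, curvature]
  simp only [Pi.sub_apply, map_sub]
  rw [coord_covariantDerivative hz (derivative hY), coord_covariantDerivative hz (derivative hX),
    coord_covariantDerivative hz (hZ.differentiableAt (by simp)),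
    alongDeriv_congr (localField_covariantDerivative hZ Y),
    alongDeriv_congr (localField_covariantDerivative hZ X)]

lemma coord_curvatureAt [I.Boundaryless] [T2Space M]
    (hn : CovariantDerivative.ContMDiffCovariantDerivative nabla ∞) (z : M)
    (a b c : TangentSpace I z) :
    coord I z z (curvatureAt nabla z a b c) =
      localCurvature (christoffel nabla z) (extChartAt I z z) (coord I z z a) (coord I z z b)
        (coord I z z c) := by
  rw [curvatureAt, coord_curvature hn (contDiffAt_localField_extend z a)
    (contDiffAt_localField_extend z b) (contDiffAt_localField_extend z c)]
  simp only [FiberBundle.extend_apply_self]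

end Christoffel

end LocalLeviCivita

section AlongCoordinates

open Filter Topology Bundle

variable {E : Type*} [NormedAddCommGroup E] [NormedSpace ℝ E]
  {H : Type*} [TopologicalSpace H] {I : ModelWithCorners ℝ E H}
  {M : Type*} [TopologicalSpace M] [ChartedSpace H M]
  {E' : Type*} [NormedAddCommGroup E'] [NormedSpace ℝ E']
  {H' : Type*} [TopologicalSpace H'] {I' : ModelWithCorners ℝ E' H'}
  {N : Type*} [TopologicalSpace N] [ChartedSpace H' N]

variable (I I') in
/-- The map `f` in the charts at `u` and `f u`. -/
noncomputable def localMap (f : M → N) (u : M) (t : E) : E' :=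
  extChartAt I' (f u) (f ((extChartAt I u).symm t))

@[simp]
lemma localMap_self (f : M → N) (u : M) :
    localMap I I' f u (extChartAt I u u) = extChartAt I' (f u) (f u) := by
  simp [localMap]

lemma localMap_apply {f : M → N} {u q : M} (hq : q ∈ (chartAt H u).source) :
    localMap I I' f u (extChartAt I u q) = extChartAt I' (f u) (f q) := by
  rw [localMap, (extChartAt I u).left_inv (by rwa [extChartAt_source])]

variable [IsManifold I ∞ M] [IsManifold I' ∞ N]

omit [IsManifold I' ∞ N] in
lemma contDiffAt_localMap [I.Boundaryless] {f : M → N} (hf : ContMDiff I I' ∞ f) (u : M) :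
    ContDiffAt ℝ ∞ (localMap I I' f u) (extChartAt I u u) :=
  contDiffAt_chart (a := fun q ↦ extChartAt I' (f u) (f q))
    ((contMDiffAt_extChartAt (n := ∞) (x := f u)).comp u hf.contMDiffAt)

lemma fderiv_localMap [I.Boundaryless] {f : M → N} (hf : ContMDiff I I' ∞ f) {u q : M}
    (hq : q ∈ (chartAt H u).source) (hfq : f q ∈ (chartAt H' (f u)).source)
    (x : TangentSpace I q) :
    fderiv ℝ (localMap I I' f u) (extChartAt I u q) (coord I u q x) =
      coord I' (f u) (f q) (mfderiv I I' f q x) := by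
  have hfd : MDifferentiableAt I I' f q := (hf q).mdifferentiableAt (by simp)
  have hψ : MDifferentiableAt I' 𝓘(ℝ, E') (extChartAt I' (f u)) (f q) :=
    mdifferentiableAt_extChartAt hfq
  rw [coord_eq_mfderiv hfq]
  exact (mvfderiv_eq_fderiv hq (hψ.comp q hfd) x).symm.trans (mfderiv_comp_apply q hψ hfd x)

variable (I I') in
/-- The components of a vector field along `f` in the charts at `u` and `f u`. -/
noncomputable def localAlong (f : M → N) (V : Π q : M, TangentSpace I' (f q)) (u : M) (t : E) :
    E' :=
  coord I' (f u) (f ((extChartAt I u).symm t)) (V ((extChartAt I u).symm t))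

omit [IsManifold I ∞ M] in
lemma localAlong_apply {f : M → N} (V : Π q : M, TangentSpace I' (f q)) {u q : M}
    (hq : q ∈ (chartAt H u).source) :
    localAlong I I' f V u (extChartAt I u q) = coord I' (f u) (f q) (V q) := by
  rw [localAlong, (extChartAt I u).left_inv (by rwa [extChartAt_source])]

omit [IsManifold I ∞ M] in
lemma localAlong_self {f : M → N} (V : Π q : M, TangentSpace I' (f q)) (u : M) :
    localAlong I I' f V u (extChartAt I u u) = coord I' (f u) (f u) (V u) :=
  localAlong_apply V (mem_chart_source H u)

lemma contDiffAt_localAlong [I.Boundaryless] {f : M → N} {V : Π q : M, TangentSpace I' (f q)}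
    {U : Set M} {u : M} (hf : ContMDiff I I' ∞ f)
    (hV : ContMDiffOn I I'.tangent ∞ (fun p ↦ (⟨f p, V p⟩ : TangentBundle I' N)) U)
    (hU : U ∈ 𝓝 u) : ContDiffAt ℝ ∞ (localAlong I I' f V u) (extChartAt I u u) := by
  have h := (contMDiffAt_totalSpace.1 (hV.contMDiffAt hU)).2
  refine (contDiffAt_chart h).congr_of_eventuallyEq ?_
  filter_upwards [eventually_extChartAt_symm (hf.continuous.continuousAt.eventually
    (eventually_mem_chart_source (mem_chart_source H' (f u))))] with t ht
  exact coord_apply ht _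

omit [IsManifold I ∞ M] [IsManifold I' ∞ N] in
lemma eventually_mem_charts {f : M → N} (hf : ContMDiff I I' ∞ f) (u : M) :
    ∀ᶠ q in 𝓝 u, q ∈ (chartAt H u).source ∧ f q ∈ (chartAt H' (f u)).source :=
  (eventually_mem_chart_source (mem_chart_source H u)).and
    (hf.continuous.continuousAt.eventually
      (eventually_mem_chart_source (mem_chart_source H' (f u))))

lemma localAlong_mfderiv [I.Boundaryless] {f : M → N} (hf : ContMDiff I I' ∞ f)
    (Y : Π q : M, TangentSpace I q) (u : M) :
    localAlong I I' f (fun q ↦ mfderiv I I' f q (Y q)) u =ᶠ[𝓝 (extChartAt I u u)]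
      fun t ↦ fderiv ℝ (localMap I I' f u) t (localField I Y u t) := by
  refine eventually_of_eventually_extChartAt ?_
  filter_upwards [eventually_mem_charts hf u] with q hq
  rw [localAlong_apply _ hq.1, localField_apply _ hq.1, fderiv_localMap hf hq.1 hq.2]

variable [FiniteDimensional ℝ E']

omit [IsManifold I ∞ M] in
lemma metric_eq_localMetric_along (g : SemiRiemannianMetric I' N) {f : M → N} {u q : M}
    (hq : q ∈ (chartAt H u).source) (hfq : f q ∈ (chartAt H' (f u)).source)
    (v w : TangentSpace I' (f q)) :
    g.val (f q) v w = localMetric g (f u) (localMap I I' f u (extChartAt I u q))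
      (coord I' (f u) (f q) v) (coord I' (f u) (f q) w) := by
  rw [localMap_apply hq, metric_eq_localMetric g hfq]

section CovDerivAlong

variable [I.Boundaryless] [I'.Boundaryless]
  (nabla : CovariantDerivative I' E' (TangentSpace I' : N → Type _))

lemma coord_covDerivAlong {f : M → N} (hf : ContMDiff I I' ∞ f) {u q : M}
    (hq : q ∈ (chartAt H u).source) (hfq : f q ∈ (chartAt H' (f u)).source)
    {V : Π q : M, TangentSpace I' (f q)}
    (hV : DifferentiableAt ℝ (localAlong I I' f V u) (extChartAt I u q)) (x : TangentSpace I q) :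
    coord I' (f u) (f q) (covDerivAlong nabla f V q x) =
      alongDeriv (christoffel nabla (f u)) (localMap I I' f u) (localAlong I I' f V u)
        (extChartAt I u q) (coord I u q x) := by
  have hfd : MDifferentiableAt I I' f q := (hf q).mdifferentiableAt (by simp)
  have hV' : MDifferentiableAt I 𝓘(ℝ, E') (fun p ↦ coord I' (f u) (f p) (V p)) q :=
    mdifferentiableAt_of_chart hq hV
  rw [covDerivAlong_eq nabla hfq hfd hV', map_add, coord_ofCoord hfq, ← christoffel_apply hfq,
    mvfderiv_eq_fderiv hq hV', alongDeriv, localMap_apply hq, localAlong_apply V hq,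
    fderiv_localMap hf hq hfq]
  rfl

lemma localAlong_covDerivAlong {f : M → N} (hf : ContMDiff I I' ∞ f) {u : M}
    {V : Π q : M, TangentSpace I' (f q)}
    (hV : ContDiffAt ℝ ∞ (localAlong I I' f V u) (extChartAt I u u))
    (Y : Π q : M, TangentSpace I q) :
    localAlong I I' f (fun q ↦ covDerivAlong nabla f V q (Y q)) u =ᶠ[𝓝 (extChartAt I u u)]
      fun t ↦ alongDeriv (christoffel nabla (f u)) (localMap I I' f u) (localAlong I I' f V u) t
        (localField I Y u t) := by
  refine eventually_of_eventually_extChartAt ?_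
  filter_upwards [eventually_mem_charts hf u,
    eventually_extChartAt (eventually_differentiableAt hV)] with q hq hd
  rw [localAlong_apply _ hq.1, localField_apply _ hq.1, coord_covDerivAlong nabla hf hq.1 hq.2 hd]

lemma coord_covDerivAlong_self {f : M → N} (hf : ContMDiff I I' ∞ f) {u : M}
    {V : Π q : M, TangentSpace I' (f q)}
    (hV : ContDiffAt ℝ ∞ (localAlong I I' f V u) (extChartAt I u u)) (x : TangentSpace I u) :
    coord I' (f u) (f u) (covDerivAlong nabla f V u x) =
      alongDeriv (christoffel nabla (f u)) (localMap I I' f u) (localAlong I I' f V u)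
        (extChartAt I u u) (coord I u u x) :=
  coord_covDerivAlong nabla hf (mem_chart_source H u) (mem_chart_source H' (f u))
    (hV.differentiableAt (by simp)) x

end CovDerivAlong

end AlongCoordinates

section Algebra

variable {V W : Type*} [AddCommGroup V] [Module ℝ V] [AddCommGroup W] [Module ℝ W]

/-- The pullback of a quadrilinear form along a linear map. -/
def quadrilinearPullback (F : W →ₗ[ℝ] W →ₗ[ℝ] W →ₗ[ℝ] W →ₗ[ℝ] ℝ) (A : V →ₗ[ℝ] W) :
    V →ₗ[ℝ] V →ₗ[ℝ] V →ₗ[ℝ] V →ₗ[ℝ] ℝ :=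
  LinearMap.mk₂ ℝ (fun x y ↦ (F (A x) (A y)).compl₁₂ A A)
    (fun _ _ _ ↦ by ext; simp) (fun _ _ _ ↦ by ext; simp)
    (fun _ _ _ ↦ by ext; simp) (fun _ _ _ ↦ by ext; simp)

/-- Half of the Kulkarni-Nomizu square of a bilinear form, with the sign that it has in the Gauss
equation for `g(R(x, y) z, w)`. -/
def kulkarniNomizu (b : V →ₗ[ℝ] V →ₗ[ℝ] ℝ) : V →ₗ[ℝ] V →ₗ[ℝ] V →ₗ[ℝ] V →ₗ[ℝ] ℝ :=
  LinearMap.mk₂ ℝ (fun x y ↦ (LinearMap.mul ℝ ℝ).compl₁₂ (b y) (b x) -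
      (LinearMap.mul ℝ ℝ).compl₁₂ (b x) (b y))
    (fun _ _ _ ↦ by ext; simp; ring) (fun _ _ _ ↦ by ext; simp; ring)
    (fun _ _ _ ↦ by ext; simp; ring) (fun _ _ _ ↦ by ext; simp; ring)

@[simp]
lemma kulkarniNomizu_apply (b : V →ₗ[ℝ] V →ₗ[ℝ] ℝ) (x y z w : V) :
    kulkarniNomizu b x y z w = b y z * b x w - b x z * b y w := rfl

lemma isAlgebraicCurvatureTensor_kulkarniNomizu {b : V →ₗ[ℝ] V →ₗ[ℝ] ℝ}
    (hb : ∀ x y, b x y = b y x) : IsAlgebraicCurvatureTensor (kulkarniNomizu b) where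
  antisymm x y z w := by simp only [kulkarniNomizu_apply]; ring
  pair_symm x y z w := by
    simp only [kulkarniNomizu_apply, hb w, hb z]
    ring
  bianchi x y z w := by
    simp only [kulkarniNomizu_apply, hb y x, hb z]
    ring

namespace IsAlgebraicCurvatureTensor

lemma of_skew {F : V →ₗ[ℝ] V →ₗ[ℝ] V →ₗ[ℝ] V →ₗ[ℝ] ℝ}
    (antisymm : ∀ x y z w, F x y z w = -F y x z w)
    (skew : ∀ x y z w, F x y z w = -F x y w z)
    (bianchi : ∀ x y z w, F x y z w + F y z x w + F z x y w = 0) :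
    IsAlgebraicCurvatureTensor F where
  antisymm := antisymm
  bianchi := bianchi
  pair_symm x y z w := by
    -- the first two Bianchi identities minus the last two leave twice the claim
    linarith [bianchi x y z w, bianchi y z w x, bianchi z w x y, bianchi w x y z,
      skew x y w z, skew z w y x, skew y z w x, skew w x z y,
      antisymm x z w y, skew z x w y, antisymm y w x z, skew w y x z]

lemma skew {F : V →ₗ[ℝ] V →ₗ[ℝ] V →ₗ[ℝ] V →ₗ[ℝ] ℝ} (hF : IsAlgebraicCurvatureTensor F)
    (x y z w : V) : F x y z w = -F x y w z := by
  rw [hF.pair_symm, hF.antisymm, hF.pair_symm]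

lemma add {F G : V →ₗ[ℝ] V →ₗ[ℝ] V →ₗ[ℝ] V →ₗ[ℝ] ℝ} (hF : IsAlgebraicCurvatureTensor F)
    (hG : IsAlgebraicCurvatureTensor G) : IsAlgebraicCurvatureTensor (F + G) where
  antisymm x y z w := by
    simp only [LinearMap.add_apply, hF.antisymm x, hG.antisymm x, neg_add]
  pair_symm x y z w := by
    simp only [LinearMap.add_apply, hF.pair_symm x, hG.pair_symm x]
  bianchi x y z w := by
    simp only [LinearMap.add_apply]
    linarith [hF.bianchi x y z w, hG.bianchi x y z w]

lemma smul {F : V →ₗ[ℝ] V →ₗ[ℝ] V →ₗ[ℝ] V →ₗ[ℝ] ℝ} (hF : IsAlgebraicCurvatureTensor F) (c : ℝ) :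
    IsAlgebraicCurvatureTensor (c • F) where
  antisymm x y z w := by
    simp only [LinearMap.smul_apply, hF.antisymm x, smul_neg]
  pair_symm x y z w := by
    simp only [LinearMap.smul_apply, hF.pair_symm x]
  bianchi x y z w := by
    simp only [LinearMap.smul_apply, ← smul_add, hF.bianchi, smul_zero]

lemma sum {ι : Type*} {s : Finset ι} {F : ι → V →ₗ[ℝ] V →ₗ[ℝ] V →ₗ[ℝ] V →ₗ[ℝ] ℝ}
    (hF : ∀ i ∈ s, IsAlgebraicCurvatureTensor (F i)) :
    IsAlgebraicCurvatureTensor (∑ i ∈ s, F i) :=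
  Finset.sum_induction F IsAlgebraicCurvatureTensor (fun _ _ ↦ add)
    ⟨by simp, by simp, by simp⟩ hF

lemma pullback {F : W →ₗ[ℝ] W →ₗ[ℝ] W →ₗ[ℝ] W →ₗ[ℝ] ℝ} (hF : IsAlgebraicCurvatureTensor F)
    (A : V →ₗ[ℝ] W) : IsAlgebraicCurvatureTensor (quadrilinearPullback F A) where
  antisymm _ _ _ _ := hF.antisymm _ _ _ _
  pair_symm _ _ _ _ := hF.pair_symm _ _ _ _
  bianchi _ _ _ _ := hF.bianchi _ _ _ _

lemma apply_proj_right {F : V →ₗ[ℝ] V →ₗ[ℝ] V →ₗ[ℝ] V →ₗ[ℝ] ℝ}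
    (hF : IsAlgebraicCurvatureTensor F) {P : V →ₗ[ℝ] V} {R : Submodule ℝ V}
    (hP : ∀ x, x - P x ∈ R) (hR : ∀ x y, ∀ ζ ∈ R, ∀ z, F x (P y) ζ z = 0) (x y z w : V) :
    F x y z (P w) = F (P x) (P y) (P z) (P w) := by
  have proj_third (a b c d : V) : F a (P b) c d = F a (P b) (P c) d := by
    rw [← sub_eq_zero, ← LinearMap.sub_apply, ← map_sub, hR _ _ _ (hP c)]
  have proj_fourth (a b c d : V) : F a (P b) c d = F a (P b) c (P d) := by
    rw [hF.skew, proj_third, ← hF.skew]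
  calc F x y z (P w) = F z (P w) x y := hF.pair_symm ..
    _ = F z (P w) (P x) (P y) := by rw [proj_third, proj_fourth]
    _ = F (P x) (P y) z (P w) := hF.pair_symm ..
    _ = F (P x) (P y) (P z) (P w) := proj_third ..

end IsAlgebraicCurvatureTensor

end Algebra

section CurvatureForm

variable {E : Type*} [NormedAddCommGroup E] [NormedSpace ℝ E]

/-- The curvature tensor with its last index lowered, for a metric `G` and Christoffel symbols `Γ`
on an open subset of `E`. -/
noncomputable def localCurvatureForm (G : E → E →L[ℝ] E →L[ℝ] ℝ) (Γ : E → E →L[ℝ] E →L[ℝ] E)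
    (y : E) : E →ₗ[ℝ] E →ₗ[ℝ] E →ₗ[ℝ] E →ₗ[ℝ] ℝ :=
  LinearMap.mk₂ ℝ
    (fun c b ↦ LinearMap.mk₂ ℝ (fun a d ↦ G y (localCurvature Γ y c b a) d)
      (fun _ _ _ ↦ by simp only [localCurvature, map_add, map_sub, add_apply, sub_apply]; ring)
      (fun _ _ _ ↦ by
        simp only [localCurvature, map_smul, map_add, map_sub, add_apply, sub_apply, smul_apply,
          smul_eq_mul]
        ring)
      (fun _ _ _ ↦ map_add ..) (fun _ _ _ ↦ map_smul ..))
    (fun _ _ _ ↦ by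
      ext
      simp only [localCurvature, map_add, map_sub, add_apply, sub_apply, LinearMap.add_apply,
        LinearMap.mk₂_apply]
      ring)
    (fun _ _ _ ↦ by
      ext
      simp only [localCurvature, map_smul, map_add, map_sub, add_apply, sub_apply, smul_apply,
        LinearMap.smul_apply, LinearMap.mk₂_apply, smul_eq_mul]
      ring)
    (fun _ _ _ ↦ by
      ext
      simp only [localCurvature, map_add, map_sub, add_apply, sub_apply, LinearMap.add_apply,
        LinearMap.mk₂_apply]
      ring)
    (fun _ _ _ ↦ by
      ext
      simp only [localCurvature, map_smul, map_add, map_sub, add_apply, sub_apply, smul_apply,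
        LinearMap.smul_apply, LinearMap.mk₂_apply, smul_eq_mul]
      ring)

lemma localCurvatureForm_apply (G : E → E →L[ℝ] E →L[ℝ] ℝ) (Γ : E → E →L[ℝ] E →L[ℝ] E)
    (y c b a d : E) : localCurvatureForm G Γ y c b a d = G y (localCurvature Γ y c b a) d := rfl

lemma IsLocalLeviCivita.isAlgebraicCurvatureTensor {G : E → E →L[ℝ] E →L[ℝ] ℝ}
    {Γ : E → E →L[ℝ] E →L[ℝ] E} {y : E} (h : IsLocalLeviCivita G Γ y) :
    IsAlgebraicCurvatureTensor (localCurvatureForm G Γ y) :=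
  .of_skew
    (fun _ _ _ _ ↦ by
      simp only [localCurvatureForm_apply]
      rw [localCurvature_antisymm, map_neg, neg_apply])
    (fun _ _ _ _ ↦ h.localCurvature_skew ..)
    (fun _ _ _ _ ↦ by
      simp only [localCurvatureForm_apply]
      rw [← add_apply, ← add_apply, ← map_add, ← map_add, h.localCurvature_bianchi, map_zero,
        zero_apply])

variable [FiniteDimensional ℝ E]
  {H : Type*} [TopologicalSpace H] {I : ModelWithCorners ℝ E H}
  {M : Type*} [TopologicalSpace M] [ChartedSpace H M] [IsManifold I ∞ M]

/-- The curvature tensor `g(R(a, b) c, d)` of a Levi-Civita connection, constructed in the chart at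
`z`. -/
noncomputable def curvatureForm (g : SemiRiemannianMetric I M)
    (nabla : CovariantDerivative I E (TangentSpace I : M → Type _)) (z : M) :
    TangentSpace I z →ₗ[ℝ] TangentSpace I z →ₗ[ℝ] TangentSpace I z →ₗ[ℝ] TangentSpace I z →ₗ[ℝ] ℝ :=
  quadrilinearPullback
    (localCurvatureForm (localMetric g z) (christoffel nabla z) (extChartAt I z z))
    (coord I z z).toLinearMap

variable [I.Boundaryless] [T2Space M] {g : SemiRiemannianMetric I M}
  {nabla : CovariantDerivative I E (TangentSpace I : M → Type _)}

lemma curvatureForm_apply (hn : g.IsLeviCivita nabla) (z : M) (a b c d : TangentSpace I z) :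
    curvatureForm g nabla z a b c d = g.val z (curvatureAt nabla z a b c) d := by
  rw [metric_eq_localMetric g (mem_chart_source H z), coord_curvatureAt hn.smooth]
  rfl

lemma isAlgebraicCurvatureTensor_curvatureForm (hn : g.IsLeviCivita nabla) (z : M) :
    IsAlgebraicCurvatureTensor (curvatureForm g nabla z) :=
  (isLocalLeviCivita hn z).isAlgebraicCurvatureTensor.pullback _

end CurvatureForm

section NullFrames

variable {E : Type*} [NormedAddCommGroup E] [NormedSpace ℝ E]
  {H : Type*} [TopologicalSpace H] {I : ModelWithCorners ℝ E H}
  {M : Type*} [TopologicalSpace M] [ChartedSpace H M]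
  {E' : Type*} [NormedAddCommGroup E'] [NormedSpace ℝ E']
  {H' : Type*} [TopologicalSpace H'] {I' : ModelWithCorners ℝ E' H'}
  {N : Type*} [TopologicalSpace N] [ChartedSpace H' N] [IsManifold I' ∞ N]
  {g : SemiRiemannianMetric I' N} {f : M → N} {p : M}

lemma mem_radical_iff {ζ : TangentSpace I p} :
    ζ ∈ radical g f p ↔ ∀ y, g.val (f p) (mfderiv I I' f p ζ) (mfderiv I I' f p y) = 0 := by
  rw [radical, LinearMap.mem_ker, LinearMap.ext_iff]
  rfl

lemma metric_mfderiv_radical {ζ : TangentSpace I p} (hζ : ζ ∈ radical g f p)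
    (y : TangentSpace I p) : g.val (f p) (mfderiv I I' f p y) (mfderiv I I' f p ζ) = 0 := by
  rw [g.symm]
  exact mem_radical_iff.1 hζ y

variable [IsManifold I ∞ M] {S : ScreenDistribution I g f} {r : ℕ}

lemma ScreenDistribution.sub_proj_mem (S : ScreenDistribution I g f) (y : TangentSpace I p) :
    y - S.proj p y ∈ radical g f p :=
  Submodule.sub_projection_mem (S.isCompl p) y

lemma ScreenDistribution.proj_mem (S : ScreenDistribution I g f) (y : TangentSpace I p) :
    S.proj p y ∈ S.fiber p :=
  Submodule.projection_apply_mem (S.isCompl p) y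

lemma metric_mfderiv_proj (S : ScreenDistribution I g f) (x y : TangentSpace I p) :
    g.val (f p) (mfderiv I I' f p x) (mfderiv I I' f p (S.proj p y)) =
      g.val (f p) (mfderiv I I' f p x) (mfderiv I I' f p y) := by
  have h := metric_mfderiv_radical (S.sub_proj_mem y) x
  rw [map_sub, map_sub, sub_eq_zero] at h
  exact h.symm

namespace IsDistributionFrameOn

lemma mem {D : ∀ q : M, Submodule ℝ (TangentSpace I q)} {k : ℕ}
    {X : Fin k → Π q : M, TangentSpace I q} {U : Set M} (h : IsDistributionFrameOn D X U)
    (hp : p ∈ U) (i : Fin k) : X i p ∈ D p := by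
  rw [← h.span_eq p hp]
  exact Submodule.subset_span ⟨i, rfl⟩

end IsDistributionFrameOn

namespace IsNullFramePairOn

variable {L : ∀ p : M, Submodule ℝ (TangentSpace I' (f p))}
  {ξ : Fin r → Π p : M, TangentSpace I p} {ν : Fin r → Π p : M, TangentSpace I' (f p)} {U : Set M}

lemma radical_eq_sum (h : IsNullFramePairOn S L ξ ν U) (hp : p ∈ U) {ζ : TangentSpace I p}
    (hζ : ζ ∈ radical g f p) :
    ζ = ∑ i, g.val (f p) (mfderiv I I' f p ζ) (ν i p) • ξ i p := by
  rw [← h.frame.span_eq p hp, Submodule.mem_span_range_iff_exists_fun] at hζ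
  obtain ⟨c, rfl⟩ := hζ
  refine Finset.sum_congr rfl fun i _ ↦ ?_
  congr 1
  simp [h.dual p hp]

lemma transversal_eq_sum (h : IsNullFramePairOn S L ξ ν U) (hp : p ∈ U)
    {l : TangentSpace I' (f p)} (hl : l ∈ L p) :
    l = ∑ i, g.val (f p) l (mfderiv I I' f p (ξ i p)) • ν i p := by
  rw [← h.span_eq p hp, Submodule.mem_span_range_iff_exists_fun] at hl
  obtain ⟨c, rfl⟩ := hl
  refine Finset.sum_congr rfl fun i _ ↦ ?_
  congr 1
  have dual (j : Fin r) :
      g.val (f p) (ν j p) (mfderiv I I' f p (ξ i p)) = if i = j then 1 else 0 := by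
    rw [g.symm, h.dual p hp]
  simp [dual]

lemma proj_eq (h : IsNullFramePairOn S L ξ ν U) (hp : p ∈ U) (y : TangentSpace I p) :
    S.proj p y = y - ∑ i, g.val (f p) (mfderiv I I' f p y) (ν i p) • ξ i p := by
  rw [eq_sub_iff_add_eq', ← eq_sub_iff_add_eq, h.radical_eq_sum hp (S.sub_proj_mem y)]
  refine Finset.sum_congr rfl fun i _ ↦ ?_
  rw [map_sub, map_sub, sub_apply, h.orthogonal_screen p hp i _ (S.proj_mem y), sub_zero]

lemma metric_transversal_transversal (h : IsNullFramePairOn S L ξ ν U) (hp : p ∈ U)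
    {l : TangentSpace I' (f p)} (hl : l ∈ L p) (i : Fin r) : g.val (f p) l (ν i p) = 0 := by
  rw [h.transversal_eq_sum hp hl, map_sum, sum_apply]
  refine Finset.sum_eq_zero fun j _ ↦ ?_
  rw [map_smul, smul_apply, h.null p hp, smul_zero]

lemma metric_transversal_screen (h : IsNullFramePairOn S L ξ ν U) (hp : p ∈ U)
    {l : TangentSpace I' (f p)} (hl : l ∈ L p) {x : TangentSpace I p} (hx : x ∈ S.fiber p) :
    g.val (f p) l (mfderiv I I' f p x) = 0 := by
  rw [h.transversal_eq_sum hp hl, map_sum, sum_apply]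
  refine Finset.sum_eq_zero fun i _ ↦ ?_
  rw [map_smul, smul_apply, g.symm (f p) (ν i p), h.orthogonal_screen p hp i x hx, smul_zero]

end IsNullFramePairOn

variable (hf : Manifold.IsImmersion I I' ∞ f) (L : LightlikeTransversalBundle S r)

lemma sub_mfderiv_tangentialPart_mem (v : TangentSpace I' (f p)) :
    v - mfderiv I I' f p (tangentialPart hf L p v) ∈ L.fiber p := by
  have hinj := injective_mfderiv_of_isImmersion hf p
  rw [← LinearMap.ker_linearProjOfIsCompl (L.fiber p) (mfderiv I I' f p).toLinearMap hinj
    (L.isCompl p), LinearMap.mem_ker, map_sub]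
  exact sub_eq_zero.2 (LinearMap.linearProjOfIsCompl_apply_left (L.fiber p)
    (mfderiv I I' f p).toLinearMap hinj (L.isCompl p) (tangentialPart hf L p v)).symm

lemma mfderiv_tangentialPart {ξ : Fin r → Π p : M, TangentSpace I p}
    {ν : Fin r → Π p : M, TangentSpace I' (f p)} {U : Set M}
    (h : IsNullFramePairOn S L.fiber ξ ν U) (hp : p ∈ U) (v : TangentSpace I' (f p)) :
    mfderiv I I' f p (tangentialPart hf L p v) =
      v - ∑ i, g.val (f p) v (mfderiv I I' f p (ξ i p)) • ν i p := by
  rw [eq_sub_iff_add_eq', ← eq_sub_iff_add_eq,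
    h.transversal_eq_sum hp (sub_mfderiv_tangentialPart_mem hf L v)]
  refine Finset.sum_congr rfl fun i _ ↦ ?_
  rw [map_sub, sub_apply, metric_mfderiv_radical (h.frame.mem hp i), sub_zero]

lemma inducedMetric_tangentialPart (v : TangentSpace I' (f p)) (w : TangentSpace I p) :
    inducedMetric g f p (tangentialPart hf L p v) w =
      g.val (f p) v (mfderiv I I' f p (S.proj p w)) := by
  obtain ⟨U, -, hp, ξ, ν, h⟩ := L.exists_frame p
  have orthogonal := h.metric_transversal_screen hp (sub_mfderiv_tangentialPart_mem hf L v)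
    (S.proj_mem w)
  rw [map_sub, sub_apply, sub_eq_zero] at orthogonal
  rw [orthogonal, metric_mfderiv_proj]
  rfl

end NullFrames

section AlongCalculus

open Filter Topology Bundle

variable {E : Type*} [NormedAddCommGroup E] [NormedSpace ℝ E]
  {H : Type*} [TopologicalSpace H] {I : ModelWithCorners ℝ E H}
  {M : Type*} [TopologicalSpace M] [ChartedSpace H M]
  {E' : Type*} [NormedAddCommGroup E'] [NormedSpace ℝ E']
  {H' : Type*} [TopologicalSpace H'] {I' : ModelWithCorners ℝ E' H'}
  {N : Type*} [TopologicalSpace N] [ChartedSpace H' N] [IsManifold I' ∞ N]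

lemma localAlong_congr {f : M → N} {u : M} {V W : Π q : M, TangentSpace I' (f q)}
    (h : ∀ᶠ q in 𝓝 u, V q = W q) :
    localAlong I I' f V u =ᶠ[𝓝 (extChartAt I u u)] localAlong I I' f W u := by
  filter_upwards [eventually_extChartAt_symm h] with t ht
  rw [localAlong, localAlong, ht]

lemma localAlong_sub_sum_smul {ι : Type*} [Fintype ι] {f : M → N} {u : M}
    (V : Π q : M, TangentSpace I' (f q)) (a : ι → M → ℝ)
    (W : ι → Π q : M, TangentSpace I' (f q)) (t : E) :
    localAlong I I' f (fun q ↦ V q - ∑ i, a i q • W i q) u t =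
      localAlong I I' f V u t -
        ∑ i, (a i ∘ (extChartAt I u).symm) t • localAlong I I' f (W i) u t := by
  rw [localAlong, map_sub, map_sum]
  exact congrArg _ (Finset.sum_congr rfl fun i _ ↦ map_smul _ _ _)

variable (I I') in
/-- The vector field `V` along `f` is smooth at `u`. -/
def SmoothAlongAt (f : M → N) (V : Π q : M, TangentSpace I' (f q)) (u : M) : Prop :=
  ContDiffAt ℝ ∞ (localAlong I I' f V u) (extChartAt I u u)

lemma SmoothAlongAt.congr {f : M → N} {u : M} {V W : Π q : M, TangentSpace I' (f q)}
    (hV : SmoothAlongAt I I' f V u) (h : ∀ᶠ q in 𝓝 u, W q = V q) : SmoothAlongAt I I' f W u :=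
  ContDiffAt.congr_of_eventuallyEq hV (localAlong_congr h)

lemma SmoothAlongAt.sub_sum_smul {ι : Type*} [Fintype ι] {f : M → N} {u : M}
    {V : Π q : M, TangentSpace I' (f q)} {a : ι → M → ℝ}
    {W : ι → Π q : M, TangentSpace I' (f q)} (hV : SmoothAlongAt I I' f V u)
    (ha : ∀ i, ContDiffAt ℝ ∞ (a i ∘ (extChartAt I u).symm) (extChartAt I u u))
    (hW : ∀ i, SmoothAlongAt I I' f (W i) u) :
    SmoothAlongAt I I' f (fun q ↦ V q - ∑ i, a i q • W i q) u := by
  rw [SmoothAlongAt, funext (localAlong_sub_sum_smul V a W)]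
  exact ContDiffAt.sub hV (ContDiffAt.sum fun i _ ↦ (ha i).smul (hW i))

section Metric

variable [FiniteDimensional ℝ E'] {g : SemiRiemannianMetric I' N} {f : M → N}

lemma metric_self (u : M) (v w : TangentSpace I' (f u)) :
    g.val (f u) v w = localMetric g (f u) (localMap I I' f u (extChartAt I u u))
      (coord I' (f u) (f u) v) (coord I' (f u) (f u) w) :=
  metric_eq_localMetric_along (I := I) g (mem_chart_source H u) (mem_chart_source H' (f u)) v w

lemma metric_eventuallyEq [I.Boundaryless] (hf : ContMDiff I I' ∞ f)
    (V W : Π q : M, TangentSpace I' (f q)) (u : M) :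
    (fun q ↦ g.val (f q) (V q) (W q)) ∘ (extChartAt I u).symm =ᶠ[𝓝 (extChartAt I u u)]
      fun t ↦ localMetric g (f u) (localMap I I' f u t) (localAlong I I' f V u t)
        (localAlong I I' f W u t) := by
  refine eventually_of_eventually_extChartAt ?_
  filter_upwards [eventually_mem_charts hf u] with q hq
  rw [localAlong_apply _ hq.1, localAlong_apply _ hq.1, Function.comp_apply,
    (extChartAt I u).left_inv (by simpa using hq.1),
    metric_eq_localMetric_along (I := I) g hq.1 hq.2]

lemma isLocalLeviCivita_localMap [I'.Boundaryless] [T2Space N]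
    {nabla : CovariantDerivative I' E' (TangentSpace I' : N → Type _)}
    (hn : g.IsLeviCivita nabla) (f : M → N) (u : M) :
    IsLocalLeviCivita (localMetric g (f u)) (christoffel nabla (f u))
      (localMap I I' f u (extChartAt I u u)) := by
  rw [localMap_self]
  exact isLocalLeviCivita hn (f u)

end Metric

variable [IsManifold I ∞ M]

variable (I) in
/-- The vector field `X` is smooth at `u`. -/
def SmoothFieldAt (X : Π q : M, TangentSpace I q) (u : M) : Prop :=
  ContDiffAt ℝ ∞ (localField I X u) (extChartAt I u u)

lemma SmoothFieldAt.congr {u : M} {V W : Π q : M, TangentSpace I q}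
    (hV : SmoothFieldAt I V u) (h : ∀ᶠ q in 𝓝 u, W q = V q) : SmoothFieldAt I W u := by
  refine ContDiffAt.congr_of_eventuallyEq hV ?_
  filter_upwards [eventually_extChartAt_symm h] with t ht
  rw [localField, localField, ht]

lemma SmoothFieldAt.mfderiv [I.Boundaryless] {f : M → N} (hf : ContMDiff I I' ∞ f) {u : M}
    {Y : Π q : M, TangentSpace I q} (hY : SmoothFieldAt I Y u) :
    SmoothAlongAt I I' f (fun q ↦ mfderiv I I' f q (Y q)) u :=
  ((contDiffAt_fderiv (contDiffAt_localMap hf u)).clm_apply hY).congr_of_eventuallyEq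
    (localAlong_mfderiv hf Y u)

lemma localField_sub_sum_smul {ι : Type*} [Fintype ι] {u : M}
    (V : Π q : M, TangentSpace I q) (a : ι → M → ℝ)
    (W : ι → Π q : M, TangentSpace I q) (t : E) :
    localField I (fun q ↦ V q - ∑ i, a i q • W i q) u t =
      localField I V u t -
        ∑ i, (a i ∘ (extChartAt I u).symm) t • localField I (W i) u t := by
  rw [localField, map_sub, map_sum]
  exact congrArg _ (Finset.sum_congr rfl fun i _ ↦ map_smul _ _ _)

lemma SmoothFieldAt.sub_sum_smul {ι : Type*} [Fintype ι] {u : M}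
    {V : Π q : M, TangentSpace I q} {a : ι → M → ℝ}
    {W : ι → Π q : M, TangentSpace I q} (hV : SmoothFieldAt I V u)
    (ha : ∀ i, ContDiffAt ℝ ∞ (a i ∘ (extChartAt I u).symm) (extChartAt I u u))
    (hW : ∀ i, SmoothFieldAt I (W i) u) :
    SmoothFieldAt I (fun q ↦ V q - ∑ i, a i q • W i q) u := by
  rw [SmoothFieldAt, funext (localField_sub_sum_smul V a W)]
  exact ContDiffAt.sub hV (ContDiffAt.sum fun i _ ↦ (ha i).smul (hW i))

variable [I.Boundaryless] [I'.Boundaryless] [FiniteDimensional ℝ E']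
  {nabla : CovariantDerivative I' E' (TangentSpace I' : N → Type _)} {f : M → N}

lemma covDerivAlong_congr (hf : ContMDiff I I' ∞ f) {u : M}
    {V W : Π q : M, TangentSpace I' (f q)} (hW : SmoothAlongAt I I' f W u)
    (h : ∀ᶠ q in 𝓝 u, V q = W q) (x : TangentSpace I u) :
    covDerivAlong nabla f V u x = covDerivAlong nabla f W u x := by
  apply coord_injective (mem_chart_source H' (f u))
  rw [coord_covDerivAlong_self nabla hf hW, coord_covDerivAlong_self nabla hf (hW.congr h),
    alongDeriv_congr (localAlong_congr h)]

lemma covDerivAlong_sub_sum_smul {ι : Type*} [Fintype ι] (hf : ContMDiff I I' ∞ f) {u : M}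
    {V : Π q : M, TangentSpace I' (f q)} {a : ι → M → ℝ}
    {W : ι → Π q : M, TangentSpace I' (f q)} (hV : SmoothAlongAt I I' f V u)
    (ha : ∀ i, ContDiffAt ℝ ∞ (a i ∘ (extChartAt I u).symm) (extChartAt I u u))
    (hW : ∀ i, SmoothAlongAt I I' f (W i) u) (x : TangentSpace I u) :
    covDerivAlong nabla f (fun q ↦ V q - ∑ i, a i q • W i q) u x =
      covDerivAlong nabla f V u x -
        ∑ i, (mvfderiv I (a i) u x • W i u + a i u • covDerivAlong nabla f (W i) u x) := by
  apply coord_injective (mem_chart_source H' (f u))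
  have hd : ∀ i, DifferentiableAt ℝ (localAlong I I' f (W i) u) (extChartAt I u u) :=
    fun i ↦ ContDiffAt.differentiableAt (hW i) (by simp)
  have had : ∀ i, DifferentiableAt ℝ (a i ∘ (extChartAt I u).symm) (extChartAt I u u) :=
    fun i ↦ (ha i).differentiableAt (by simp)
  rw [coord_covDerivAlong_self nabla hf (hV.sub_sum_smul ha hW), map_sub, map_sum,
    coord_covDerivAlong_self nabla hf hV, funext (localAlong_sub_sum_smul V a W),
    alongDeriv_sub_sum (ContDiffAt.differentiableAt hV (by simp))
      (fun i ↦ (had i).fun_smul (hd i))]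
  congr 1
  refine Finset.sum_congr rfl fun i _ ↦ ?_
  rw [alongDeriv_smul (had i) (hd i), map_add, map_smul, map_smul,
    coord_covDerivAlong_self nabla hf (hW i), localAlong_self,
    mvfderiv_eq_fderiv (mem_chart_source H u)
      (mdifferentiableAt_of_chart (mem_chart_source H u) (had i)),
    Function.comp_apply, extChartAt_to_inv]

variable [T2Space N] {g : SemiRiemannianMetric I' N}

lemma SmoothAlongAt.metric (hn : g.IsLeviCivita nabla) (hf : ContMDiff I I' ∞ f)
    {V W : Π q : M, TangentSpace I' (f q)} {u : M}
    (hV : SmoothAlongAt I I' f V u) (hW : SmoothAlongAt I I' f W u) :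
    ContDiffAt ℝ ∞ ((fun q ↦ g.val (f q) (V q) (W q)) ∘ (extChartAt I u).symm)
      (extChartAt I u u) := by
  refine ContDiffAt.congr_of_eventuallyEq ?_ (metric_eventuallyEq hf V W u)
  exact ((ContDiffAt.comp _ (isLocalLeviCivita_localMap hn f u).smooth_metric
    (contDiffAt_localMap hf u)).clm_apply hV).clm_apply hW

lemma SmoothAlongAt.covDerivAlong (hn : g.IsLeviCivita nabla) (hf : ContMDiff I I' ∞ f)
    {V : Π q : M, TangentSpace I' (f q)} {u : M} {Y : Π q : M, TangentSpace I q}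
    (hV : SmoothAlongAt I I' f V u) (hY : SmoothFieldAt I Y u) :
    SmoothAlongAt I I' f (fun q ↦ CoisotropicGeometry.covDerivAlong nabla f V q (Y q)) u :=
  (contDiffAt_alongDeriv (isLocalLeviCivita_localMap hn f u).smooth_symbols
    (contDiffAt_localMap hf u) hV hY).congr_of_eventuallyEq
    (localAlong_covDerivAlong nabla hf hV Y)

lemma metric_covDerivAlong_of_orthogonal (hn : g.IsLeviCivita nabla) (hf : ContMDiff I I' ∞ f)
    {V W : Π q : M, TangentSpace I' (f q)} {u : M}
    (hV : SmoothAlongAt I I' f V u) (hW : SmoothAlongAt I I' f W u)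
    (h : ∀ᶠ q in 𝓝 u, g.val (f q) (V q) (W q) = 0) (x : TangentSpace I u) :
    g.val (f u) (covDerivAlong nabla f V u x) (W u) =
      -g.val (f u) (V u) (covDerivAlong nabla f W u x) := by
  rw [metric_self (I := I), metric_self (I := I), coord_covDerivAlong_self nabla hf hV,
    coord_covDerivAlong_self nabla hf hW, ← localAlong_self (I := I) V,
    ← localAlong_self (I := I) W]
  refine (isLocalLeviCivita_localMap hn f u).metric_alongDeriv_of_orthogonal
    ((contDiffAt_localMap hf u).differentiableAt (by simp))
    (ContDiffAt.differentiableAt hV (by simp)) (ContDiffAt.differentiableAt hW (by simp)) ?_ _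
  filter_upwards [metric_eventuallyEq (g := g) hf V W u, eventually_extChartAt_symm h] with t ht ht'
  rw [← ht]
  exact ht'

lemma covDerivAlong_commutator [FiniteDimensional ℝ E] (hn : g.IsLeviCivita nabla)
    (hf : ContMDiff I I' ∞ f) {V : Π q : M, TangentSpace I' (f q)} {u : M}
    {X Y : Π q : M, TangentSpace I q} (hV : SmoothAlongAt I I' f V u)
    (hX : SmoothFieldAt I X u) (hY : SmoothFieldAt I Y u) :
    covDerivAlong nabla f (fun q ↦ covDerivAlong nabla f V q (Y q)) u (X u) -
      covDerivAlong nabla f (fun q ↦ covDerivAlong nabla f V q (X q)) u (Y u) -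
      covDerivAlong nabla f V u (VectorField.mlieBracket I X Y u) =
    curvatureAt nabla (f u) (mfderiv I I' f u (X u)) (mfderiv I I' f u (Y u)) (V u) := by
  have hX' := ContDiffAt.differentiableAt hX (by simp)
  have hY' := ContDiffAt.differentiableAt hY (by simp)
  apply coord_injective (mem_chart_source H' (f u))
  rw [coord_curvatureAt hn.smooth, map_sub, map_sub,
    coord_covDerivAlong_self nabla hf (hV.covDerivAlong hn hf hX),
    coord_covDerivAlong_self nabla hf (hV.covDerivAlong hn hf hY),
    coord_covDerivAlong_self nabla hf hV, coord_mlieBracket (mem_chart_source H u) hX' hY',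
    alongDeriv_congr (localAlong_covDerivAlong nabla hf hV Y),
    alongDeriv_congr (localAlong_covDerivAlong nabla hf hV X), ← localField_self,
    ← localField_self, alongDeriv_commutator
      ((isLocalLeviCivita_localMap hn f u).smooth_symbols.differentiableAt (by simp))
      (contDiffAt_localMap hf u) hV hX' hY', localField_self, localField_self,
    fderiv_localMap hf (mem_chart_source H u) (mem_chart_source H' (f u)),
    fderiv_localMap hf (mem_chart_source H u) (mem_chart_source H' (f u)), localAlong_self,
    localMap_self]

end AlongCalculus

section HessianForm

open Filter Topology Bundle

variable {E : Type*} [NormedAddCommGroup E] [NormedSpace ℝ E]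
  {H : Type*} [TopologicalSpace H] {I : ModelWithCorners ℝ E H}
  {M : Type*} [TopologicalSpace M] [ChartedSpace H M] [IsManifold I ∞ M]
  {E' : Type*} [NormedAddCommGroup E'] [NormedSpace ℝ E'] [FiniteDimensional ℝ E']
  {H' : Type*} [TopologicalSpace H'] {I' : ModelWithCorners ℝ E' H'}
  {N : Type*} [TopologicalSpace N] [ChartedSpace H' N] [IsManifold I' ∞ N]

variable (I) in
/-- The scalar second fundamental form of `f` at `u` in the direction of a vector `ζ` of the
radical: the component along `df ζ` of the Hessian of `f`, computed in the charts at `u` and `f u`.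
As `df ζ` is orthogonal to the image of `df`, it does not depend on the charts, and for `ζ = ξ i` it
is the local second fundamental form `h^l_i`. -/
noncomputable def hessianForm (g : SemiRiemannianMetric I' N)
    (nabla : CovariantDerivative I' E' (TangentSpace I' : N → Type _)) (f : M → N) (u : M)
    (ζ : TangentSpace I u) : TangentSpace I u →ₗ[ℝ] TangentSpace I u →ₗ[ℝ] ℝ :=
  LinearMap.mk₂ ℝ (fun x y ↦ localMetric g (f u) (localMap I I' f u (extChartAt I u u))
    (localHessian (christoffel nabla (f u)) (localMap I I' f u) (extChartAt I u u)
      (coord I u u x) (coord I u u y)) (coord I' (f u) (f u) (mfderiv I I' f u ζ)))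
    (fun x x' y ↦ by simp only [localHessian, map_add, add_apply]; ring)
    (fun c x y ↦ by
      simp only [localHessian, map_smul, map_add, add_apply, smul_apply, smul_eq_mul]
      ring)
    (fun x y y' ↦ by simp only [localHessian, map_add, add_apply]; ring)
    (fun c x y ↦ by
      simp only [localHessian, map_smul, map_add, add_apply, smul_apply, smul_eq_mul]
      ring)

lemma hessianForm_apply (g : SemiRiemannianMetric I' N)
    (nabla : CovariantDerivative I' E' (TangentSpace I' : N → Type _)) (f : M → N) (u : M)
    (ζ x y : TangentSpace I u) : hessianForm I g nabla f u ζ x y =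
      localMetric g (f u) (localMap I I' f u (extChartAt I u u))
        (localHessian (christoffel nabla (f u)) (localMap I I' f u) (extChartAt I u u)
          (coord I u u x) (coord I u u y)) (coord I' (f u) (f u) (mfderiv I I' f u ζ)) := rfl

lemma fderiv_extChartAt_comp {E₀ : Type*} [NormedAddCommGroup E₀] [NormedSpace ℝ E₀] {j : E₀ → M}
    {u : M} {t : E₀} (ht : j t ∈ (chartAt H u).source) (hj : MDifferentiableAt 𝓘(ℝ, E₀) I j t)
    (v : E₀) : fderiv ℝ (extChartAt I u ∘ j) t v = coord I u (j t) (mfderiv 𝓘(ℝ, E₀) I j t v) := by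
  rw [coord_eq_mfderiv ht, ← mfderiv_eq_fderiv,
    mfderiv_comp t (mdifferentiableAt_extChartAt (I := I) ht) hj]
  rfl

variable [I.Boundaryless] [I'.Boundaryless]
  {g : SemiRiemannianMetric I' N} {nabla : CovariantDerivative I' E' (TangentSpace I' : N → Type _)}
  {f : M → N}

lemma metric_covDerivAlong_mfderiv (hf : ContMDiff I I' ∞ f) {u : M}
    {Y : Π q : M, TangentSpace I q} (hY : SmoothFieldAt I Y u) {ζ : TangentSpace I u}
    (hζ : ζ ∈ radical g f u) (x : TangentSpace I u) :
    g.val (f u) (covDerivAlong nabla f (fun q ↦ mfderiv I I' f q (Y q)) u x)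
      (mfderiv I I' f u ζ) = hessianForm I g nabla f u ζ x (Y u) := by
  have orthogonal := metric_mfderiv_radical hζ
    (ofCoord I u u (fderiv ℝ (localField I Y u) (extChartAt I u u) (coord I u u x)))
  rw [metric_self (I := I), ← fderiv_localMap hf (mem_chart_source H u) (mem_chart_source H' (f u)),
    coord_ofCoord (mem_chart_source H u)] at orthogonal
  rw [metric_self (I := I), coord_covDerivAlong_self nabla hf (hY.mfderiv hf),
    alongDeriv_congr (localAlong_mfderiv hf Y u), alongDeriv_fderiv_apply (contDiffAt_localMap hf u)
      (ContDiffAt.differentiableAt hY (by simp)), map_add, add_apply, orthogonal,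
      add_zero, hessianForm_apply, localField_self]

variable [T2Space N]

lemma hessianForm_symm (hn : g.IsLeviCivita nabla) (hf : ContMDiff I I' ∞ f) {u : M}
    (ζ x y : TangentSpace I u) :
    hessianForm I g nabla f u ζ x y = hessianForm I g nabla f u ζ y x := by
  rw [hessianForm_apply, hessianForm_apply,
    (isLocalLeviCivita_localMap hn f u).localHessian_symm (contDiffAt_localMap hf u)]

lemma hessianForm_skew (hn : g.IsLeviCivita nabla) (hf : ContMDiff I I' ∞ f) {u : M}
    {ξ η : Π q : M, TangentSpace I q} (hξ : SmoothFieldAt I ξ u) (hη : SmoothFieldAt I η u)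
    (hξ' : ∀ᶠ q in 𝓝 u, ξ q ∈ radical g f q) (hη' : ∀ᶠ q in 𝓝 u, η q ∈ radical g f q)
    (x : TangentSpace I u) :
    hessianForm I g nabla f u (ξ u) x (η u) = -hessianForm I g nabla f u (η u) x (ξ u) := by
  rw [← metric_covDerivAlong_mfderiv hf hη hξ'.self_of_nhds,
    ← metric_covDerivAlong_mfderiv hf hξ hη'.self_of_nhds,
    metric_covDerivAlong_of_orthogonal hn hf (hη.mfderiv hf) (hξ.mfderiv hf), g.symm]
  filter_upwards [hξ'] with q hq using metric_mfderiv_radical hq _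

lemma hessianForm_mfderiv_symm (hn : g.IsLeviCivita nabla) (hf : ContMDiff I I' ∞ f)
    {E₀ : Type*} [NormedAddCommGroup E₀] [NormedSpace ℝ E₀] {j : E₀ → M} {s : E₀}
    (hjs : ContMDiffAt 𝓘(ℝ, E₀) I ∞ j s)
    (hj : ∀ᶠ t in 𝓝 s, MDifferentiableAt 𝓘(ℝ, E₀) I j t ∧
      ∀ v, mfderiv 𝓘(ℝ, E₀) I j t v ∈ radical g f (j t)) (a b : E₀) (y : TangentSpace I (j s)) :
    hessianForm I g nabla f (j s) (mfderiv 𝓘(ℝ, E₀) I j s b) (mfderiv 𝓘(ℝ, E₀) I j s a) y =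
      hessianForm I g nabla f (j s) (mfderiv 𝓘(ℝ, E₀) I j s a) (mfderiv 𝓘(ℝ, E₀) I j s b) y := by
  have hs := mem_chart_source H (j s)
  have hk : ContDiffAt ℝ ∞ (extChartAt I (j s) ∘ j) s := by
    rw [← contMDiffAt_iff_contDiffAt]
    exact (contMDiffAt_extChartAt (n := ∞) (x := j s)).comp s hjs
  have orthogonal : ∀ᶠ t in 𝓝 s, ∀ v y,
      localMetric g (f (j s)) (localMap I I' f (j s) ((extChartAt I (j s) ∘ j) t))
        (fderiv ℝ (localMap I I' f (j s)) ((extChartAt I (j s) ∘ j) t)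
          (fderiv ℝ (extChartAt I (j s) ∘ j) t v))
        (fderiv ℝ (localMap I I' f (j s)) ((extChartAt I (j s) ∘ j) t) y) = 0 := by
    filter_upwards [hj, hjs.continuousAt.eventually (eventually_mem_charts hf (j s))]
      with t ⟨ht, hrad⟩ ⟨hjt, hft⟩ v y
    have h0 := mem_radical_iff.1 (hrad v) (ofCoord I (j s) (j t) y)
    rwa [metric_eq_localMetric_along (I := I) g hjt hft, ← fderiv_localMap hf hjt hft,
      ← fderiv_localMap hf hjt hft, coord_ofCoord hjt, ← fderiv_extChartAt_comp hjt ht] at h0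
  have h := (isLocalLeviCivita_localMap hn f (j s)).metric_localHessian_leaf_symm
    (k := extChartAt I (j s) ∘ j) (s₀ := s) (contDiffAt_localMap hf (j s)) hk orthogonal a b
    (coord I (j s) (j s) y)
  rwa [fderiv_extChartAt_comp hs hj.self_of_nhds.1, fderiv_extChartAt_comp hs hj.self_of_nhds.1,
    Function.comp_apply, fderiv_localMap hf hs (mem_chart_source H' (f (j s))),
    fderiv_localMap hf hs (mem_chart_source H' (f (j s)))] at h

lemma hessianForm_symm_of_integrable (hn : g.IsLeviCivita nabla) (hf : ContMDiff I I' ∞ f) {k : ℕ}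
    (hint : IsIntegrableDistribution k (radical (I := I) g f)) {u : M} {ζ η : TangentSpace I u}
    (hζ : ζ ∈ radical g f u) (hη : η ∈ radical g f u) (y : TangentSpace I u) :
    hessianForm I g nabla f u η ζ y = hessianForm I g nabla f u ζ η y := by
  obtain ⟨U, j, hU, ⟨s, hs, rfl⟩, hj, hrad⟩ := hint u
  have hjt : ∀ t ∈ U, ContMDiffAt (𝓡 k) I ∞ j t := fun t ht ↦ hj.contMDiffAt (hU.mem_nhds ht)
  rw [← (hrad s hs).2] at hζ hη
  obtain ⟨a, rfl⟩ := hζ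
  obtain ⟨b, rfl⟩ := hη
  refine hessianForm_mfderiv_symm hn hf (hjt s hs) ?_ a b y
  filter_upwards [hU.mem_nhds hs] with t ht
  refine ⟨(hjt t ht).mdifferentiableAt (by simp), fun v ↦ ?_⟩
  rw [← (hrad t ht).2]
  exact ⟨v, rfl⟩

lemma hessianForm_eq_zero_of_mem_radical (hn : g.IsLeviCivita nabla) (hf : ContMDiff I I' ∞ f)
    {k r : ℕ} (hint : IsIntegrableDistribution k (radical (I := I) g f)) {u : M}
    {ξ : Fin r → Π q : M, TangentSpace I q} {U : Set M} (hU : U ∈ 𝓝 u)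
    (hξ : IsDistributionFrameOn (radical g f) ξ U) (i : Fin r) (x : TangentSpace I u)
    {ζ : TangentSpace I u} (hζ : ζ ∈ radical g f u) :
    hessianForm I g nabla f u (ξ i u) x ζ = 0 := by
  have hmem (j : Fin r) : ∀ᶠ q in 𝓝 u, ξ j q ∈ radical g f q := by
    filter_upwards [hU] with q hq using hξ.mem hq j
  rw [← hξ.span_eq u (mem_of_mem_nhds hU)] at hζ
  induction hζ using Submodule.span_induction with
  | mem ζ h =>
    obtain ⟨j, rfl⟩ := h
    have skew := hessianForm_skew hn hf (contDiffAt_localField (hξ.smooth i) hU)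
      (contDiffAt_localField (hξ.smooth j) hU) (hmem i) (hmem j) x
    have symm :=
      hessianForm_symm_of_integrable hn hf hint (hmem i).self_of_nhds (hmem j).self_of_nhds x
    rw [hessianForm_symm hn hf, hessianForm_symm hn hf (ξ i u)] at symm
    linarith
  | zero => simp
  | add ζ η _ _ h1 h2 => rw [map_add, h1, h2, add_zero]
  | smul c ζ _ h => rw [map_smul, h, smul_zero]

end HessianForm

section GaussEquation

open Filter Topology

variable {E : Type*} [NormedAddCommGroup E] [NormedSpace ℝ E]
  {H : Type*} [TopologicalSpace H] {I : ModelWithCorners ℝ E H}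
  {M : Type*} [TopologicalSpace M] [ChartedSpace H M] [IsManifold I ∞ M]
  {E' : Type*} [NormedAddCommGroup E'] [NormedSpace ℝ E']
  {H' : Type*} [TopologicalSpace H'] {I' : ModelWithCorners ℝ E' H'}
  {N : Type*} [TopologicalSpace N] [ChartedSpace H' N] [IsManifold I' ∞ N]
  {g : SemiRiemannianMetric I' N} {nabla : CovariantDerivative I' E' (TangentSpace I' : N → Type _)}
  {f : M → N} {S : ScreenDistribution I g f} {r : ℕ}
  {ξ : Fin r → Π p : M, TangentSpace I p} {ν : Fin r → Π p : M, TangentSpace I' (f p)} {U : Set M}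
  {hf : Manifold.IsImmersion I I' ∞ f} {L : LightlikeTransversalBundle S r}

lemma IsNullFramePairOn.metric_screenSecondForm (h : IsNullFramePairOn S L.fiber ξ ν U) {u : M}
    (hu : u ∈ U) (X W : Π q : M, TangentSpace I q) (i : Fin r) :
    g.val (f u) (mfderiv I I' f u (screenSecondForm nabla hf L X W u)) (ν i u) =
      g.val (f u) (covDerivAlong nabla f (fun q ↦ mfderiv I I' f q (S.proj q (W q))) u (X u))
        (ν i u) := by
  have transversal := h.metric_transversal_transversal hu
    (sub_mfderiv_tangentialPart_mem hf L
      (covDerivAlong nabla f (fun q ↦ mfderiv I I' f q (S.proj q (W q))) u (X u))) i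
  rw [map_sub, sub_apply, sub_eq_zero] at transversal
  rw [screenSecondForm, map_sub, map_sub, sub_apply,
    h.orthogonal_screen u hu i _ (S.proj_mem _), sub_zero, transversal, inducedConnection]

variable [I.Boundaryless] [FiniteDimensional ℝ E'] [I'.Boundaryless]

lemma metric_lightlikeSecondForm {u : M} {X Y : Π q : M, TangentSpace I q}
    (hY : SmoothFieldAt I Y u) {ζ : TangentSpace I u} (hζ : ζ ∈ radical g f u) :
    g.val (f u) (lightlikeSecondForm nabla hf L X Y u) (mfderiv I I' f u ζ) =
      hessianForm I g nabla f u ζ (X u) (Y u) := by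
  rw [lightlikeSecondForm, map_sub, sub_apply, metric_mfderiv_radical hζ, sub_zero,
    metric_covDerivAlong_mfderiv hf.contMDiff hY hζ]

namespace IsNullFramePairOn

variable [T2Space N]

lemma smoothFieldAt_proj {L : ∀ p : M, Submodule ℝ (TangentSpace I' (f p))}
    (h : IsNullFramePairOn S L ξ ν U) (hn : g.IsLeviCivita nabla) (hf : ContMDiff I I' ∞ f)
    {u : M} (hU : U ∈ 𝓝 u) {W : Π q : M, TangentSpace I q} (hW : SmoothFieldAt I W u) :
    SmoothFieldAt I (fun q ↦ S.proj q (W q)) u := by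
  refine SmoothFieldAt.congr (hW.sub_sum_smul
    (a := fun i q ↦ g.val (f q) (mfderiv I I' f q (W q)) (ν i q)) (W := ξ)
    (fun i ↦ (hW.mfderiv hf).metric hn hf (contDiffAt_localAlong hf (h.smooth i) hU))
    (fun i ↦ contDiffAt_localField (h.frame.smooth i) hU)) ?_
  filter_upwards [hU] with q hq using h.proj_eq hq (W q)

lemma metric_covDerivAlong_transversal (h : IsNullFramePairOn S L.fiber ξ ν U)
    (hn : g.IsLeviCivita nabla) {u : M} (hU : U ∈ 𝓝 u) {X W : Π q : M, TangentSpace I q}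
    (hW : SmoothFieldAt I W u) (i : Fin r) :
    g.val (f u) (covDerivAlong nabla f (ν i) u (X u)) (mfderiv I I' f u (S.proj u (W u))) =
      -g.val (f u) (mfderiv I I' f u (screenSecondForm nabla hf L X W u)) (ν i u) := by
  have orthogonal : ∀ᶠ q in 𝓝 u, g.val (f q) (ν i q) (mfderiv I I' f q (S.proj q (W q))) = 0 := by
    filter_upwards [hU] with q hq
    rw [g.symm, h.orthogonal_screen q hq i _ (S.proj_mem _)]
  rw [h.metric_screenSecondForm (mem_of_mem_nhds hU), g.symm (f u) _ (ν i u)]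
  exact metric_covDerivAlong_of_orthogonal hn hf.contMDiff
    (contDiffAt_localAlong hf.contMDiff (h.smooth i) hU)
    ((h.smoothFieldAt_proj hn hf.contMDiff hU hW).mfderiv hf.contMDiff) orthogonal (X u)

lemma metric_covDerivAlong_inducedConnection (h : IsNullFramePairOn S L.fiber ξ ν U)
    (hn : g.IsLeviCivita nabla) {u : M} (hU : U ∈ 𝓝 u) {Y Z : Π q : M, TangentSpace I q}
    (hY : SmoothFieldAt I Y u) (hZ : SmoothFieldAt I Z u) (x w : TangentSpace I u) :
    g.val (f u) (covDerivAlong nabla f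
        (fun q ↦ mfderiv I I' f q (inducedConnection nabla hf L Y Z q)) u x)
        (mfderiv I I' f u (S.proj u w)) =
      g.val (f u) (covDerivAlong nabla f
        (fun q ↦ covDerivAlong nabla f (fun q ↦ mfderiv I I' f q (Z q)) q (Y q)) u x)
        (mfderiv I I' f u (S.proj u w)) -
      ∑ i, hessianForm I g nabla f u (ξ i u) (Y u) (Z u) *
        g.val (f u) (covDerivAlong nabla f (ν i) u x) (mfderiv I I' f u (S.proj u w)) := by
  have hu := mem_of_mem_nhds hU
  have hD := (hZ.mfderiv hf.contMDiff).covDerivAlong hn hf.contMDiff hY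
  have ha := fun i ↦ hD.metric hn hf.contMDiff
    (SmoothFieldAt.mfderiv hf.contMDiff (contDiffAt_localField (h.frame.smooth i) hU))
  have hν := fun i ↦ contDiffAt_localAlong hf.contMDiff (h.smooth i) hU
  rw [covDerivAlong_congr hf.contMDiff (hD.sub_sum_smul ha hν) (by
      filter_upwards [hU] with q hq using mfderiv_tangentialPart hf L h hq _),
    covDerivAlong_sub_sum_smul hf.contMDiff hD ha hν x, map_sub, map_sum, sub_apply, sum_apply]
  congr 1
  refine Finset.sum_congr rfl fun i _ ↦ ?_
  rw [map_add, map_smul, map_smul, add_apply, smul_apply, smul_apply, g.symm (f u) (ν i u),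
    h.orthogonal_screen u hu i _ (S.proj_mem w), smul_zero, zero_add, smul_eq_mul,
    metric_covDerivAlong_mfderiv hf.contMDiff hZ (h.frame.mem hu i)]

lemma gauss_equation [FiniteDimensional ℝ E] (h : IsNullFramePairOn S L.fiber ξ ν U)
    (hn : g.IsLeviCivita nabla) {u : M} (hU : U ∈ 𝓝 u) {X Y Z W : Π q : M, TangentSpace I q}
    (hX : SmoothFieldAt I X u) (hY : SmoothFieldAt I Y u) (hZ : SmoothFieldAt I Z u)
    (hW : SmoothFieldAt I W u) :
    inducedMetric g f u (curvature (inducedConnection nabla hf L) X Y Z u) (W u) =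
      curvatureForm g nabla (f u) (mfderiv I I' f u (X u)) (mfderiv I I' f u (Y u))
        (mfderiv I I' f u (Z u)) (mfderiv I I' f u (S.proj u (W u))) +
      ∑ i, (hessianForm I g nabla f u (ξ i u) (Y u) (Z u) *
          g.val (f u) (mfderiv I I' f u (screenSecondForm nabla hf L X W u)) (ν i u) -
        hessianForm I g nabla f u (ξ i u) (X u) (Z u) *
          g.val (f u) (mfderiv I I' f u (screenSecondForm nabla hf L Y W u)) (ν i u)) := by
  have expand : inducedMetric g f u (curvature (inducedConnection nabla hf L) X Y Z u) (W u) =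
      inducedMetric g f u (tangentialPart hf L u (covDerivAlong nabla f
        (fun q ↦ mfderiv I I' f q (inducedConnection nabla hf L Y Z q)) u (X u))) (W u) -
      inducedMetric g f u (tangentialPart hf L u (covDerivAlong nabla f
        (fun q ↦ mfderiv I I' f q (inducedConnection nabla hf L X Z q)) u (Y u))) (W u) -
      inducedMetric g f u (tangentialPart hf L u (covDerivAlong nabla f
        (fun q ↦ mfderiv I I' f q (Z q)) u (VectorField.mlieBracket I X Y u))) (W u) := by
    rw [← LinearMap.sub_apply, ← LinearMap.sub_apply, ← map_sub, ← map_sub]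
    rfl
  simp only [expand, inducedMetric_tangentialPart, curvatureForm_apply hn,
    h.metric_covDerivAlong_inducedConnection hn hU hY hZ,
    h.metric_covDerivAlong_inducedConnection hn hU hX hZ,
    h.metric_covDerivAlong_transversal (hf := hf) (L := L) hn hU hW,
    ← covDerivAlong_commutator hn hf.contMDiff (hZ.mfderiv hf.contMDiff) hX hY, map_sub, sub_apply,
    mul_neg, Finset.sum_neg_distrib, Finset.sum_sub_distrib]
  ring

lemma metric_lightlikeSecondForm_proj (h : IsNullFramePairOn S L.fiber ξ ν U)
    (hn : g.IsLeviCivita nabla) {k : ℕ}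
    (hint : IsIntegrableDistribution k (radical (I := I) g f)) {u : M} (hU : U ∈ 𝓝 u)
    {X W : Π q : M, TangentSpace I q} (hW : SmoothFieldAt I W u) (i : Fin r) :
    g.val (f u) (lightlikeSecondForm nabla hf L X (fun q ↦ S.proj q (W q)) u)
        (mfderiv I I' f u (ξ i u)) =
      hessianForm I g nabla f u (ξ i u) (X u) (W u) := by
  rw [metric_lightlikeSecondForm (h.smoothFieldAt_proj hn hf.contMDiff hU hW)
    (h.frame.mem (mem_of_mem_nhds hU) i), eq_comm, ← sub_eq_zero, ← map_sub]
  exact hessianForm_eq_zero_of_mem_radical hn hf.contMDiff hint hU h.frame i _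
    (S.sub_proj_mem (W u))

end IsNullFramePairOn

end GaussEquation

section ScreenConformal

open Topology

variable {E : Type*} [NormedAddCommGroup E] [NormedSpace ℝ E]
  {H : Type*} [TopologicalSpace H] {I : ModelWithCorners ℝ E H}
  {M : Type*} [TopologicalSpace M] [ChartedSpace H M] [IsManifold I ∞ M]
  {E' : Type*} [NormedAddCommGroup E'] [NormedSpace ℝ E'] [FiniteDimensional ℝ E']
  {H' : Type*} [TopologicalSpace H'] {I' : ModelWithCorners ℝ E' H'} [I'.Boundaryless]
  {N : Type*} [TopologicalSpace N] [ChartedSpace H' N] [IsManifold I' ∞ N] [T2Space N]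
  {g : SemiRiemannianMetric I' N} {nabla : CovariantDerivative I' E' (TangentSpace I' : N → Type _)}
  {f : M → N} {hf : Manifold.IsImmersion I I' ∞ f} {S : ScreenDistribution I g f} {r : ℕ}
  {L : LightlikeTransversalBundle S r}

lemma curvatureForm_mfderiv_proj_right (hn : g.IsLeviCivita nabla) {u : M}
    (hhol : ∀ x y : TangentSpace I u, ∀ ξ ∈ radical g f u, ∃ ζ ∈ radical g f u,
      curvatureAt nabla (f u) (mfderiv I I' f u x) (mfderiv I I' f u (S.proj u y))
        (mfderiv I I' f u ξ) = mfderiv I I' f u ζ) (x y z w : TangentSpace I u) :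
    curvatureForm g nabla (f u) (mfderiv I I' f u x) (mfderiv I I' f u y) (mfderiv I I' f u z)
        (mfderiv I I' f u (S.proj u w)) =
      quadrilinearPullback (curvatureForm g nabla (f u))
        ((mfderiv I I' f u).toLinearMap ∘ₗ S.proj u) x y z w := by
  refine ((isAlgebraicCurvatureTensor_curvatureForm hn (f u)).pullback
    (mfderiv I I' f u).toLinearMap).apply_proj_right S.sub_proj_mem (fun x y ξ hξ z ↦ ?_) x y z w
  obtain ⟨ζ, hζ, preserves⟩ := hhol x y ξ hξ
  calc curvatureForm g nabla (f u) (mfderiv I I' f u x) (mfderiv I I' f u (S.proj u y))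
        (mfderiv I I' f u ξ) (mfderiv I I' f u z)
      = g.val (f u) (mfderiv I I' f u ζ) (mfderiv I I' f u z) := by
        rw [curvatureForm_apply hn, preserves]
    _ = 0 := mem_radical_iff.1 hζ z

variable [I.Boundaryless] [FiniteDimensional ℝ E]

lemma IsNullFramePairOn.gauss_equation_of_screenConformal
    {ξ : Fin r → Π p : M, TangentSpace I p} {ν : Fin r → Π p : M, TangentSpace I' (f p)}
    {U : Set M} (h : IsNullFramePairOn S L.fiber ξ ν U) (hn : g.IsLeviCivita nabla) {k : ℕ}
    (hint : IsIntegrableDistribution k (radical (I := I) g f)) {φ : Fin r → M → ℝ}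
    (hconf : ∀ X Y : Π q : M, TangentSpace I q, SmoothFieldOn X U → SmoothFieldOn Y U →
      ∀ q ∈ U, ∀ i, g.val (f q) (mfderiv I I' f q (screenSecondForm nabla hf L X Y q)) (ν i q) =
        φ i q * g.val (f q) (lightlikeSecondForm nabla hf L X (fun q' ↦ S.proj q' (Y q')) q)
          (mfderiv I I' f q (ξ i q)))
    {u : M} (hU : U ∈ 𝓝 u) {X Y Z W : Π q : M, TangentSpace I q} (hX : SmoothFieldOn X U)
    (hY : SmoothFieldOn Y U) (hZ : SmoothFieldOn Z U) (hW : SmoothFieldOn W U) :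
    inducedMetric g f u (curvature (inducedConnection nabla hf L) X Y Z u) (W u) =
      curvatureForm g nabla (f u) (mfderiv I I' f u (X u)) (mfderiv I I' f u (Y u))
        (mfderiv I I' f u (Z u)) (mfderiv I I' f u (S.proj u (W u))) +
      ∑ i, φ i u * kulkarniNomizu (hessianForm I g nabla f u (ξ i u)) (X u) (Y u) (Z u) (W u) := by
  have hW' := contDiffAt_localField hW hU
  have screenForm (V : Π q : M, TangentSpace I q) (hV : SmoothFieldOn V U) (i : Fin r) :
      g.val (f u) (mfderiv I I' f u (screenSecondForm nabla hf L V W u)) (ν i u) =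
        φ i u * hessianForm I g nabla f u (ξ i u) (V u) (W u) := by
    rw [hconf V W hV hW u (mem_of_mem_nhds hU) i,
      h.metric_lightlikeSecondForm_proj hn hint hU hW' i]
  rw [h.gauss_equation hn hU (contDiffAt_localField hX hU) (contDiffAt_localField hY hU)
    (contDiffAt_localField hZ hU) hW']
  congr 1
  refine Finset.sum_congr rfl fun i _ ↦ ?_
  rw [screenForm X hX, screenForm Y hY, kulkarniNomizu_apply]
  ring

theorem theorem3p5_general (hn : g.IsLeviCivita nabla)
    (hf : Manifold.IsImmersion I I' ∞ f) (L : LightlikeTransversalBundle S r)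
    (hconf : IsScreenConformal nabla hf L)
    (hint : IsIntegrableDistribution r (radical (I := I) g f))
    (hhol : ∀ (p : M) (x y : TangentSpace I p), ∀ ξ ∈ radical g f p, ∃ ζ ∈ radical g f p,
      curvatureAt nabla (f p) (mfderiv I I' f p x) (mfderiv I I' f p (S.proj p y))
        (mfderiv I I' f p ξ) = mfderiv I I' f p ζ) (u : M) :
    ∃ F : TangentSpace I u →ₗ[ℝ] TangentSpace I u →ₗ[ℝ] TangentSpace I u →ₗ[ℝ]
        TangentSpace I u →ₗ[ℝ] ℝ, IsAlgebraicCurvatureTensor F ∧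
      ∀ X Y Z W : Π p : M, TangentSpace I p, SmoothFieldOn X Set.univ → SmoothFieldOn Y Set.univ →
        SmoothFieldOn Z Set.univ → SmoothFieldOn W Set.univ →
        inducedMetric g f u (curvature (inducedConnection nabla hf L) X Y Z u) (W u) =
          F (X u) (Y u) (Z u) (W u) := by
  obtain ⟨U, hU, hu, ξ, ν, φ, h, -, hφ⟩ := hconf u
  refine ⟨quadrilinearPullback (curvatureForm g nabla (f u))
      ((mfderiv I I' f u).toLinearMap ∘ₗ S.proj u) +
    ∑ i, φ i u • kulkarniNomizu (hessianForm I g nabla f u (ξ i u)), ?algebraic, ?value⟩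
  case algebraic =>
    exact ((isAlgebraicCurvatureTensor_curvatureForm hn (f u)).pullback _).add
      (.sum fun i _ ↦ (isAlgebraicCurvatureTensor_kulkarniNomizu
        (hessianForm_symm hn hf.contMDiff (ξ i u))).smul (φ i u))
  case value =>
    intro X Y Z W hX hY hZ hW
    rw [h.gauss_equation_of_screenConformal hn hint hφ (hU.mem_nhds hu)
        (hX.mono (Set.subset_univ U)) (hY.mono (Set.subset_univ U)) (hZ.mono (Set.subset_univ U))
        (hW.mono (Set.subset_univ U)),
      curvatureForm_mfderiv_proj_right hn (hhol u)]
    simp only [LinearMap.add_apply, LinearMap.sum_apply, LinearMap.smul_apply, smul_eq_mul]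

end ScreenConformal

end CoisotropicGeometry

theorem theorem3p5 {m n : ℕ}
    -- the ambient semi-Riemannian manifold `N` of dimension `m + n`
    {N : Type*} [TopologicalSpace N] [T2Space N] [SecondCountableTopology N]
    [ChartedSpace (EuclideanSpace ℝ (Fin (m + n))) N] [IsManifold (𝓡 (m + n)) ∞ N]
    (g : SemiRiemannianMetric (𝓡 (m + n)) N)
    (nabla : CovariantDerivative (𝓡 (m + n)) (EuclideanSpace ℝ (Fin (m + n)))
      (TangentSpace (𝓡 (m + n)) : N → Type _))
    (hnabla : g.IsLeviCivita nabla)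
    -- the submanifold `f : M → N` of codimension `n`, its screen distribution `S`, and a lightlike
    -- transversal bundle `L`
    {M : Type*} [TopologicalSpace M] [T2Space M] [SecondCountableTopology M]
    [ChartedSpace (EuclideanSpace ℝ (Fin m)) M] [IsManifold (𝓡 m) ∞ M]
    (f : M → N) (hf : Manifold.IsImmersion (𝓡 m) (𝓡 (m + n)) ∞ f)
    (hcoiso : IsCoisotropic (𝓡 m) g f n)
    (S : ScreenDistribution (𝓡 m) g f) (L : LightlikeTransversalBundle S n)
    (hconf : IsScreenConformal nabla hf L)
    (hint : IsIntegrableDistribution n (radical (I := 𝓡 m) g f))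
    -- the holonomy condition: `R̄(X, PY)` maps `Rad TM` into `Rad TM`
    (hhol : ∀ (p : M) (x y : TangentSpace (𝓡 m) p), ∀ ξ ∈ radical g f p,
      ∃ ζ ∈ radical g f p,
        curvatureAt nabla (f p) (mfderiv (𝓡 m) (𝓡 (m + n)) f p x)
          (mfderiv (𝓡 m) (𝓡 (m + n)) f p (S.proj p y)) (mfderiv (𝓡 m) (𝓡 (m + n)) f p ξ) =
          mfderiv (𝓡 m) (𝓡 (m + n)) f p ζ) :
    -- at every point, `g(R(X, Y) Z, W)` is given by an algebraic curvature tensor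
    ∀ u : M, ∃ F : TangentSpace (𝓡 m) u →ₗ[ℝ] TangentSpace (𝓡 m) u →ₗ[ℝ]
        TangentSpace (𝓡 m) u →ₗ[ℝ] TangentSpace (𝓡 m) u →ₗ[ℝ] ℝ,
      IsAlgebraicCurvatureTensor F ∧
        ∀ X Y Z W : Π p : M, TangentSpace (𝓡 m) p,
          SmoothFieldOn X Set.univ → SmoothFieldOn Y Set.univ →
          SmoothFieldOn Z Set.univ → SmoothFieldOn W Set.univ →
          inducedMetric g f u (curvature (inducedConnection nabla hf L) X Y Z u) (W u) =
            F (X u) (Y u) (Z u) (W u) :=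
  theorem3p5_general hnabla hf L hconf hint hhol
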